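/- \textbf{Setting.} Fix $n$ and $\lambda>0$. Let $\mathbf x_1,\dots,\mathbf x_n\in\mathbb R^d$ with $\|\mathbf x_j\|_2=1$ and $|y_j|\le 1$ be training data, $\mathbf x_{te}\in\mathbb R^d$ a test point with $\|\mathbf x_{te}\|_2=1$ and label $|y_{te}|\le 1$. For $\mathbf W=[\mathbf w_1,\dots,\mathbf w_m]\in\mathbb R^{d\times m}$ let $f_{nn}(\mathbf x;\mathbf W)=\frac1{\sqrt m}\sum_{r=1}^m a_r\,\sigma(\mathbf w_r^\top\mathbf x)$ with $\sigma(z)=\max(z,0)$. Initialize independently $\mathbf w_r(0)\sim\mathcal N(\mathbf 0,\kappa^2\mathbf I_d)$, $a_r\sim\mathrm{unif}\{-1,1\}$; keep $\mathbf a$ fixed and train $\mathbf W$ by gradient flow on $\frac12\sum_j(f_{nn}(\mathbf x_j;\mathbf W)-y_j)^2+\frac\lambda2\|\mathbf W-\mathbf W(0)\|_F^2$, that is, $\mathbf W(\cdot)$ is absolutely continuous and for almost every $t\ge0$ and all $r$ $$\frac{d\mathbf w_r}{dt}=\sum_{j=1}^n\big(y_j-f_{nn}(\mathbf x_j;\mathbf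 W)\big)\frac{a_r}{\sqrt m}\,\sigma'(\mathbf w_r^\top\mathbf x_j)\,\mathbf x_j-\lambda\,(\mathbf w_r-\mathbf w_r(0)),$$ where at a kink ($\mathbf w_r^\top\mathbf x_j=0$) $\sigma'$ may be any value in $[0,1]$. With $\ell(\mathbf x;\mathbf W)=\frac12(f_{nn}(\mathbf x;\mathbf W)-y)^2$ and $H(\mathbf W)=\sum_{j=1}^n\nabla^2_{\mathbf W}\ell(\mathbf x_j;\mathbf W)+\lambda\mathbf I_{md}$, put $$\hat{\mathcal I}(\mathbf W)=\operatorname{vec}\Big(\frac{\partial\ell(\mathbf x_{te};\mathbf W)}{\partial\mathbf W}\Big)^{\!\top}H(\mathbf W)^{-1}\operatorname{vec}\Big(\frac{\partial\ell(\mathbf x_i;\mathbf W)}{\partial\mathbf W}\Big)$$ at every $\mathbf W$ with $\mathbf w_r^\top\mathbf x\ne0$ for all $r$ and all $\mathbf x\in\{\mathbf x_1,\dots,\mathbf x_n,\mathbf x_{te}\}$ (call such $\mathbf W$ smooth). The IHVP influence estimate $\hat{\mathcal I}_{nn}(\mathbf x_i,\mathbf x_{te})$ is the value of $\hat{\mathcal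 I}$ at the end of training $\mathbf W(\infty)$, understood as any limit value of $\hat{\mathcal I}(\mathbf W)$ as $\mathbf W\to\mathbf W(\infty)$ through smooth $\mathbf W$, where $\mathbf W(\infty)$ is any limit point of $\mathbf W(t)$ as $t\to\infty$. Let $\mathbf K^\infty(\mathbf x,\mathbf x')=\mathbb E_{\mathbf w\sim\mathcal N(\mathbf 0,\mathbf I_d)}\big[\mathbf x^\top\mathbf x'\,\mathbb I\{\mathbf w^\top\mathbf x\ge0,\ \mathbf w^\top\mathbf x'\ge0\}\big]$, $[\mathbf K_{tr}^\infty]_{jk}=\mathbf K^\infty(\mathbf x_j,\mathbf x_k)$, and for a point $\mathbf x$ let $\mathbf K^\infty_{\mathbf x}\in\mathbb R^n$ have entries $\mathbf K^\infty(\mathbf x,\mathbf x_j)$, with $\mathbf K_{te}^\infty=\mathbf K^\infty_{\mathbf x_{te}}$. Let $f_{ntk}(\mathbf x)=(\mathbf K^\infty_{\mathbf x})^\top(\mathbf K_{tr}^\infty+\lambda\mathbf I_n)^{-1}\mathcal Y$ with $\mathcal Y=(y_1,\dots,y_n)^\top$, and $\alpha(\mathbf x_i,\mathbf x_{te})=(\mathbf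 K_{te}^\infty)^\top(\mathbf K_{tr}^\infty+\lambda\mathbf I_n)^{-1}\mathbf e_i$. \textbf{Proposition.} For all $\varepsilon,\delta>0$ there is $\kappa_0>0$, depending only on $n,\lambda,\varepsilon,\delta$, such that for every $0<\kappa\le\kappa_0$, all training data, every test point $(\mathbf x_{te},y_{te})$ and every $i\in\{1,\dots,n\}$ as above, the following holds for all sufficiently large widths $m$: with probability at least $1-\delta$ over the random initialization, for every gradient flow trajectory from that initialization, $H(\mathbf W)$ is invertible at all smooth $\mathbf W$, the estimate $\hat{\mathcal I}_{nn}(\mathbf x_i,\mathbf x_{te})$ has at least one value, and every value satisfies $$\Big|\hat{\mathcal I}_{nn}(\mathbf x_i,\mathbf x_{te})-\alpha(\mathbf x_i,\mathbf x_{te})\,(f_{ntk}(\mathbf x_{te})-y_{te})\,(f_{ntk}(\mathbf x_i)-y_i)\Big|\le\varepsilon .$$ -/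

import Mathlib

open Filter Topology MeasureTheory ProbabilityTheory

noncomputable section

namespace IHVP

/-- Input space `ℝ^d` with the Euclidean norm. -/
abbrev E (d : ℕ) : Type := EuclideanSpace ℝ (Fin d)

/-- First-layer weights `W = [w_1, …, w_m]`, identified with `vec W`: the norm is the Frobenius
norm and the inner product is the Euclidean inner product of the vectorizations. -/
abbrev Params (d m : ℕ) : Type := PiLp 2 (fun _ : Fin m => E d)

/-! ### The network and the random initialization -/

/-- The activation `σ`. -/
def relu (z : ℝ) : ℝ := max z 0

/-- The values of `σ'(z)`: the subdifferential of the (convex) function `σ` at `z`. -/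
def reluSubdiff (z : ℝ) : Set ℝ :=
  {s | (0 < z → s = 1) ∧ (z < 0 → s = 0) ∧ 0 ≤ s ∧ s ≤ 1}

/-- `f_nn(x; W) = m^{-1/2} ∑_r a_r σ(w_rᵀ x)`. -/
def net {d m : ℕ} (a : Fin m → ℝ) (W : Params d m) (x : E d) : ℝ :=
  (1 / Real.sqrt m) * ∑ r, a r * relu (inner ℝ (W r) x)

/-- Law of the initialization `(w_1(0), …, w_m(0)), (a_1, …, a_m)`: all independent,
`w_r(0) ∼ N(0, κ² I_d)` and `a_r ∼ unif {-1, 1}`. -/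
def initLaw (d m : ℕ) (κ : ℝ) : Measure ((Fin m → E d) × (Fin m → ℝ)) :=
  (Measure.pi fun _ : Fin m => (stdGaussian (E d)).map (fun w => κ • w)).prod
    (Measure.pi fun _ : Fin m => uniformOn ({-1, 1} : Set ℝ))

/-! ### Training -/

/-- Gradient flow on
`½ ∑_j (f_nn(x_j; W) - y_j)² + (lam/2) ‖W - W(0)‖_F²` started at `W0`:
an absolutely continuous curve `W` (the integral of a locally integrable velocity `V`)
such that for almost every `t ≥ 0`
`dw_r/dt = ∑_j (y_j - f_nn(x_j; W)) m^{-1/2} a_r σ'(w_rᵀ x_j) x_j - lam (w_r - w_r(0))`.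
At a kink `w_rᵀ x_j = 0` every value of `σ'` in `[0, 1]` is admitted. -/
def IsGradientFlow {n d m : ℕ} (lam : ℝ) (X : Fin n → E d) (Y : Fin n → ℝ)
    (a : Fin m → ℝ) (W0 : Params d m) (W : ℝ → Params d m) : Prop :=
  ∃ V : ℝ → Params d m,
    (∀ t, 0 ≤ t → IntervalIntegrable V volume 0 t) ∧
    (∀ t, 0 ≤ t → W t = W0 + ∫ s in (0 : ℝ)..t, V s) ∧
    ∀ᵐ t ∂(volume.restrict (Set.Ici (0 : ℝ))),
      ∃ s : Fin m → Fin n → ℝ,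
        (∀ r j, s r j ∈ reluSubdiff (inner ℝ (W t r) (X j))) ∧
        ∀ r, V t r =
          (∑ j, ((Y j - net a (W t) (X j)) * ((1 / Real.sqrt m) * a r * s r j)) • X j)
            - lam • (W t r - W0 r)

/-! ### The IHVP influence estimate of the network -/

/-- `ℓ(x; W) = ½ (f_nn(x; W) - y)²`. -/
def loss {d m : ℕ} (a : Fin m → ℝ) (x : E d) (y : ℝ) (W : Params d m) : ℝ :=
  (1 / 2) * (net a W x - y) ^ 2

/-- `H(W) = ∑_j ∇²_W ℓ(x_j; W) + lam I`, with `∇²_W` the derivative of the gradient. -/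
def hessian {n d m : ℕ} (lam : ℝ) (X : Fin n → E d) (Y : Fin n → ℝ) (a : Fin m → ℝ)
    (W : Params d m) : Params d m →L[ℝ] Params d m :=
  (∑ j, fderiv ℝ (gradient (loss a (X j) (Y j))) W) + lam • ContinuousLinearMap.id ℝ (Params d m)

/-- `vec(∂ℓ(x_te)/∂W)ᵀ H⁻¹ vec(∂ℓ(x_i)/∂W)` at the weights `W`. -/
def ihvpAt {n d m : ℕ} (lam : ℝ) (X : Fin n → E d) (Y : Fin n → ℝ) (xte : E d) (yte : ℝ)
    (i : Fin n) (a : Fin m → ℝ) (W : Params d m) : ℝ :=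
  inner ℝ (gradient (loss a xte yte) W)
    ((hessian lam X Y a W).inverse (gradient (loss a (X i) (Y i)) W))

/-- The weights at which no neuron is at a kink of the ReLU on a training point or on the test
point. This set is open, dense, and the losses of these points are smooth functions on it. -/
def smoothWeights {n d : ℕ} (m : ℕ) (X : Fin n → E d) (xte : E d) : Set (Params d m) :=
  {W | ∀ r, inner ℝ (W r) xte ≠ 0 ∧ ∀ j, inner ℝ (W r) (X j) ≠ 0}

/-- `v` is a value at the end of training of the IHVP influence estimate: `v` is a limit value of
the classical expression `ihvpAt` along smooth weights tending to `W(∞)`, where `W(∞)` is a limit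
point of the trajectory as `t → ∞`. If `W(t)` converges to smooth weights `W(∞)`, the only such
value is `ihvpAt` at `W(∞)`. -/
def IsIHVPInfluence {n d m : ℕ} (lam : ℝ) (X : Fin n → E d) (Y : Fin n → ℝ) (xte : E d) (yte : ℝ)
    (i : Fin n) (a : Fin m → ℝ) (W : ℝ → Params d m) (v : ℝ) : Prop :=
  ∃ Winf : Params d m, MapClusterPt Winf atTop W ∧
    MapClusterPt v (𝓝[smoothWeights m X xte] Winf) (ihvpAt lam X Y xte yte i a)

/-! ### The NTK predictor -/

/-- `K^∞(x, x') = E_{w ∼ N(0, I_d)} [xᵀ x' 𝟙{wᵀ x ≥ 0, wᵀ x' ≥ 0}]`. -/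
def ntk {d : ℕ} (x x' : E d) : ℝ :=
  ∫ w, (if 0 ≤ (inner ℝ w x : ℝ) ∧ 0 ≤ (inner ℝ w x' : ℝ) then (inner ℝ x x' : ℝ) else 0)
    ∂(stdGaussian (E d))

/-- `K_tr^∞`. -/
def Ktr {n d : ℕ} (X : Fin n → E d) : Matrix (Fin n) (Fin n) ℝ :=
  Matrix.of fun j k => ntk (X j) (X k)

/-- `K_te^∞` for the test point `x`. -/
def Kte {n d : ℕ} (X : Fin n → E d) (x : E d) : Fin n → ℝ := fun j => ntk x (X j)

/-- `f_ntk(x) = (K_te^∞)ᵀ (K_tr^∞ + lam I)⁻¹ Y`. -/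
def fntk {n d : ℕ} (lam : ℝ) (X : Fin n → E d) (Y : Fin n → ℝ) (x : E d) : ℝ :=
  Kte X x ⬝ᵥ ((Ktr X + lam • (1 : Matrix (Fin n) (Fin n) ℝ))⁻¹.mulVec Y)

/-- `α(x_i, x_te) = (K_te^∞)ᵀ (K_tr^∞ + lam I)⁻¹ e_i`. -/
def alpha {n d : ℕ} (lam : ℝ) (X : Fin n → E d) (i : Fin n) (xte : E d) : ℝ :=
  Kte X xte ⬝ᵥ ((Ktr X + lam • (1 : Matrix (Fin n) (Fin n) ℝ))⁻¹.mulVec (Pi.single i 1))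

end IHVP

end

/-!
With many neurons, regularized gradient flow stays in the lazy regime: the network behaves as its
linearization at the initial weights `W0`, that is, as ridge regression with the feature vectors
`actFeat a W0 x` (the gradient of the output at `x`), whose Gram matrix is close to the neural
tangent kernel.

*The estimate at smooth weights.* The output is linear in `W` for fixed activation patterns, so at
smooth weights the loss Hessian is `∑ j, g_j g_jᵀ + lam I` with `g_j = actFeat a W (X j)`. It is
always invertible, and the push-through identity turns the influence estimate into
`kᵀ (K + lam I)⁻¹ e_i` times two residuals, where `k` and `K` are inner products of features
(`ihvpAt_eq`).

*Good initializations.* `GoodInit` asks that the initial outputs and the deviation of the empirical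
kernel from the limit kernel are at most `η`, and that every perturbation of Frobenius norm at most
`R` lets at most `η² m` neurons reach a kink. The flip condition makes the features at any weights
within `R` of `W0` `η`-close to the initial ones, and the linearization error at most `η R`.

*Dynamics.* Let `c = (K^∞ + lam I)⁻¹ Y` and `W⋆ = W0 + ∑ c_k g_k` (`ridgeWeights`). Up to errors of
order `η`, `W⋆` is the minimizer of the linearized objective, which is `lam`-strongly convex, so
`⟪W - W⋆, dW/dt⟫ ≤ -lam ‖W - W⋆‖² + O(η) ‖W - W⋆‖` as long as `W` stays near `W⋆`
(`GoodInit.inner_velocity_le`). A Gronwall estimate for absolutely continuous curves and a first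
exit argument (`norm_sq_le_of_inner_le_on_ball`) confine the trajectory and bring it within `O(η)`
of `W⋆`, where outputs and kernels are `O(η)`-close to those of the neural tangent kernel. All
constants depend on `n` and `lam` only, so `η` can be chosen from `n`, `lam`, `ε`
(`exists_forall_goodInit`).

*Probability.* By Chebyshev's inequality the initial outputs, of variance at most `κ²`, are small
once `κ` is small, which is the only constraint on `κ`. For fixed `κ` and data, the weak law of
large numbers gives the kernel approximation, and shows that few neurons start in a thin slab around
a kink hyperplane; a perturbation of norm `R` moves at most `R² / τ²` neurons by more than `τ`
(`exists_goodInit_event`).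
-/

namespace IHVP

/-! ### Confinement of absolutely continuous curves -/

theorem absolutelyContinuousOnInterval_of_dist_le {X Y : Type*} [PseudoMetricSpace X]
    [PseudoMetricSpace Y] {f : ℝ → X} {g : ℝ → Y} {a b C : ℝ}
    (hg : AbsolutelyContinuousOnInterval g a b)
    (h : ∀ s ∈ Set.uIcc a b, ∀ t ∈ Set.uIcc a b, dist (f s) (f t) ≤ C * dist (g s) (g t)) :
    AbsolutelyContinuousOnInterval f a b := by
  unfold AbsolutelyContinuousOnInterval at hg ⊢
  refine squeeze_zero' (Eventually.of_forall fun _ => Finset.sum_nonneg fun i _ => dist_nonneg) ?_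
    (by simpa using hg.const_mul C)
  rw [eventually_inf_principal]
  filter_upwards with E hE
  rw [Finset.mul_sum]
  exact Finset.sum_le_sum fun i hi => h _ (hE.1 i hi).1 _ (hE.1 i hi).2

theorem absolutelyContinuousOnInterval_primitive {F : Type*} [NormedAddCommGroup F]
    [NormedSpace ℝ F] {V : ℝ → F} {D₀ : F} {T : ℝ}
    (hV : IntervalIntegrable V volume 0 T) :
    AbsolutelyContinuousOnInterval (fun t => D₀ + ∫ s in (0 : ℝ)..t, V s) 0 T := by
  refine absolutelyContinuousOnInterval_of_dist_le (C := 1)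
    (hV.norm.absolutelyContinuousOnInterval_intervalIntegral (Set.left_mem_uIcc)) ?_
  intro s hs t ht
  have is : ∀ u ∈ Set.uIcc 0 T, IntervalIntegrable V volume 0 u := fun u hu =>
    hV.mono_set (Set.uIcc_subset_uIcc_left hu)
  rw [one_mul, dist_add_left, dist_comm, dist_comm (∫ s in (0 : ℝ)..s, ‖V s‖), dist_eq_norm,
    Real.dist_eq, intervalIntegral.integral_interval_sub_left (is t ht) (is s hs),
    intervalIntegral.integral_interval_sub_left (is t ht).norm (is s hs).norm]
  exact intervalIntegral.norm_integral_le_abs_integral_norm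

theorem absolutelyContinuousOnInterval_norm_sq {F : Type*} [NormedAddCommGroup F]
    {D : ℝ → F} {a b : ℝ}
    (hD : AbsolutelyContinuousOnInterval D a b) :
    AbsolutelyContinuousOnInterval (fun t => ‖D t‖ ^ 2) a b := by
  have h : AbsolutelyContinuousOnInterval (fun t => ‖D t‖) a b :=
    absolutelyContinuousOnInterval_of_dist_le (C := 1) hD fun s _ t _ => by
      simpa [Real.dist_eq, dist_eq_norm] using abs_norm_sub_norm_le (D s) (D t)
  simpa [pow_two] using h.fun_mul h

/-- Gronwall estimate for the squared norm of a primitive `D` of `V`: the product of `exp (lam t)`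
and `‖D t‖² - (β / lam)²` is absolutely continuous with nonpositive derivative almost everywhere. -/
theorem norm_sq_le_of_inner_le {F : Type*} [NormedAddCommGroup F]
    [InnerProductSpace ℝ F] [CompleteSpace F] {V : ℝ → F} {D₀ : F} {lam β T : ℝ} (hlam : 0 < lam)
    (hT : 0 ≤ T)
    (hV : IntervalIntegrable V volume 0 T) {D : ℝ → F}
    (hD : D = fun t => D₀ + ∫ s in (0 : ℝ)..t, V s)
    (h : ∀ᵐ t, t ∈ Set.Ioc 0 T → inner ℝ (D t) (V t) ≤ -lam * ‖D t‖ ^ 2 + β * ‖D t‖) :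
    ‖D T‖ ^ 2 ≤ Real.exp (-lam * T) * ‖D₀‖ ^ 2 + (β / lam) ^ 2 := by
  have hAC : AbsolutelyContinuousOnInterval D 0 T := by
    rw [hD]; exact absolutelyContinuousOnInterval_primitive hV
  have hexp : AbsolutelyContinuousOnInterval (fun t => Real.exp (lam * t)) 0 T := by
    refine ContDiffOn.absolutelyContinuousOnInterval (ContDiff.contDiffOn ?_)
    fun_prop
  have hconst : AbsolutelyContinuousOnInterval (fun _ : ℝ => (β / lam) ^ 2) 0 T :=
    (LipschitzWith.const _).lipschitzOnWith.absolutelyContinuousOnInterval (K := 0)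
  set ψ : ℝ → ℝ := fun t => Real.exp (lam * t) * (‖D t‖ ^ 2 - (β / lam) ^ 2) with hψ
  have hψAC : AbsolutelyContinuousOnInterval ψ 0 T :=
    hexp.fun_mul ((absolutelyContinuousOnInterval_norm_sq hAC).fun_sub hconst)
  have hle : ψ T - ψ 0 ≤ 0 := by
    rw [← hψAC.integral_deriv_eq_sub]
    rw [← neg_nonneg, ← intervalIntegral.integral_neg]
    refine intervalIntegral.integral_nonneg_of_ae_restrict hT ?_
    rw [EventuallyLE, ae_restrict_iff' measurableSet_Icc]
    have h0 : ∀ᵐ t : ℝ, t ≠ 0 := by simp [ae_iff, measure_singleton]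
    filter_upwards [h, hV.ae_hasDerivAt_integral, h0] with t ht ht' ht0 htm
    have hder : HasDerivAt D (V t) t := by
      rw [hD]
      exact (ht' (by rwa [Set.uIcc_of_le hT]) 0 (by simp)).const_add D₀
    have h1 : HasDerivAt (fun t => ‖D t‖ ^ 2) (2 * inner ℝ (D t) (V t)) t := hder.norm_sq
    have h2 : HasDerivAt (fun t => Real.exp (lam * t)) (Real.exp (lam * t) * lam) t := by
      simpa using ((hasDerivAt_id t).const_mul lam).exp
    have h3 := (h2.mul (h1.sub_const ((β / lam) ^ 2))).deriv
    have h4 : deriv ψ t = Real.exp (lam * t) * lam * (‖D t‖ ^ 2 - (β / lam) ^ 2) +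
      Real.exp (lam * t) * (2 * inner ℝ (D t) (V t)) := h3
    rw [h4]
    have h5 := ht ⟨lt_of_le_of_ne htm.1 (Ne.symm ht0), htm.2⟩
    have h6 : lam * (‖D t‖ ^ 2 - (β / lam) ^ 2) + 2 * inner ℝ (D t) (V t) ≤ 0 := by
      have : lam * (β / lam) = β := by field_simp
      have h7 : 0 ≤ lam * (‖D t‖ - β / lam) ^ 2 := by positivity
      have h8 : lam * (‖D t‖ - β / lam) ^ 2
        = lam * ‖D t‖ ^ 2 - 2 * (lam * (β / lam)) * ‖D t‖ + lam * (β / lam) ^ 2 := by ring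
      rw [this] at h8
      linarith
    have := mul_nonpos_of_nonneg_of_nonpos (Real.exp_pos (lam * t)).le h6
    simp only [Pi.zero_apply]
    linarith
  have hD0 : D 0 = D₀ := by rw [hD]; simp
  simp only [hψ, hD0, mul_zero, Real.exp_zero, one_mul] at hle
  have he : Real.exp (-lam * T) * Real.exp (lam * T) = 1 := by
    rw [← Real.exp_add]; simp
  have hle' : ‖D T‖ ^ 2 - (β / lam) ^ 2 ≤ Real.exp (-lam * T) * (‖D₀‖ ^ 2 - (β / lam) ^ 2) := by
    calc ‖D T‖ ^ 2 - (β / lam) ^ 2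
        = Real.exp (-lam * T) * (Real.exp (lam * T) * (‖D T‖ ^ 2 - (β / lam) ^ 2)) := by
          rw [← mul_assoc, he, one_mul]
      _ ≤ _ := by gcongr; linarith
  have : 0 ≤ Real.exp (-lam * T) * (β / lam) ^ 2 := by positivity
  linarith

/-- The decay estimate for the squared norm, when the differential inequality is only known inside
the ball of radius `R`: the bound keeps the curve strictly inside, so it never reaches the sphere. -/
theorem norm_sq_le_of_inner_le_on_ball {F : Type*} [NormedAddCommGroup F]
    [InnerProductSpace ℝ F] [CompleteSpace F] {V : ℝ → F} {D₀ : F} {lam β R : ℝ} (hlam : 0 < lam)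
    (hV : ∀ t, 0 ≤ t → IntervalIntegrable V volume 0 t) {D : ℝ → F}
    (hD : D = fun t => D₀ + ∫ s in (0 : ℝ)..t, V s) (hR : 0 ≤ R)
    (hR₀ : ‖D₀‖ ^ 2 + (β / lam) ^ 2 < R ^ 2)
    (h : ∀ᵐ t ∂(volume.restrict (Set.Ici (0 : ℝ))), ‖D t‖ ≤ R →
      inner ℝ (D t) (V t) ≤ -lam * ‖D t‖ ^ 2 + β * ‖D t‖) {T : ℝ} (hT : 0 ≤ T) :
    ‖D T‖ ^ 2 ≤ Real.exp (-lam * T) * ‖D₀‖ ^ 2 + (β / lam) ^ 2 := by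
  rw [ae_restrict_iff' measurableSet_Ici] at h
  have hcont : ContinuousOn D (Set.Icc 0 T) := by
    have := (absolutelyContinuousOnInterval_primitive (D₀ := D₀) (hV T hT)).continuousOn
    rwa [Set.uIcc_of_le hT, ← hD] at this
  have hstep : ∀ t, 0 ≤ t → (∀ s ∈ Set.Ioc 0 t, ‖D s‖ ≤ R) →
      ‖D t‖ ^ 2 ≤ Real.exp (-lam * t) * ‖D₀‖ ^ 2 + (β / lam) ^ 2 := by
    intro t ht hs
    refine norm_sq_le_of_inner_le hlam ht (hV t ht) hD ?_
    filter_upwards [h] with s hs' hst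
    exact hs' hst.1.le (hs s hst)
  have hlt : ∀ t, 0 ≤ t → (∀ s ∈ Set.Ioc 0 t, ‖D s‖ ≤ R) → ‖D t‖ < R := by
    intro t ht hs
    refine lt_of_pow_lt_pow_left₀ 2 hR (lt_of_le_of_lt (hstep t ht hs) (lt_of_le_of_lt ?_ hR₀))
    have : Real.exp (-lam * t) ≤ 1 := Real.exp_le_one_iff.mpr (by nlinarith)
    nlinarith [sq_nonneg ‖D₀‖]
  refine hstep T hT ?_
  by_contra! hcon
  obtain ⟨s, hs, hsR⟩ := hcon
  -- the first time at which the sphere of radius `R` is reached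
  set S : Set ℝ := {t ∈ Set.Icc 0 T | R ≤ ‖D t‖} with hS
  have hSc : IsClosed S := by
    have := hcont.norm.preimage_isClosed_of_isClosed isClosed_Icc (isClosed_Ici (a := R))
    exact this
  have hSne : S.Nonempty := ⟨s, ⟨hs.1.le, hs.2⟩, hsR.le⟩
  have hSb : BddBelow S := ⟨0, fun t ht => ht.1.1⟩
  have hmem := hSc.csInf_mem hSne hSb
  have hlt' := hlt (sInf S) hmem.1.1 fun u hu => ?_
  · exact absurd hmem.2 (not_le.mpr hlt')
  · rcases hu.2.lt_or_eq with h1 | h1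
    · have : u ∉ S := fun hu' => absurd (csInf_le hSb hu') (not_le.mpr h1)
      have h2 : ¬ R ≤ ‖D u‖ := fun hh => this ⟨⟨hu.1.le, hu.2.trans hmem.1.2⟩, hh⟩
      exact (not_le.mp h2).le
    · -- at that time itself the bound follows by continuity from the left
      rw [h1]
      have hpos : 0 < sInf S := h1 ▸ hu.1
      have hc : Tendsto (fun t => ‖D t‖) (𝓝[Set.Ioo 0 (sInf S)] (sInf S)) (𝓝 ‖D (sInf S)‖) :=
        ((hcont _ hmem.1).mono (fun x hx => ⟨hx.1.le, hx.2.le.trans hmem.1.2⟩)).norm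
      have : (𝓝[Set.Ioo 0 (sInf S)] (sInf S)).NeBot :=
        mem_closure_iff_nhdsWithin_neBot.mp (by
          rw [closure_Ioo hpos.ne]; exact ⟨hpos.le, le_rfl⟩)
      refine le_of_tendsto hc ?_
      filter_upwards [self_mem_nhdsWithin] with u hu
      have : u ∉ S := fun hu' => absurd (csInf_le hSb hu') (not_le.mpr hu.2)
      have h2 : ¬ R ≤ ‖D u‖ := fun hh => this ⟨⟨hu.1.le, hu.2.le.trans hmem.1.2⟩, hh⟩
      exact (not_le.mp h2).le

/-! ### Ridge systems -/

section Ridge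

variable {n : ℕ} {K : Matrix (Fin n) (Fin n) ℝ} {lam : ℝ}

theorem abs_le_of_ridge_mulVec_eq (hK : ∀ v, 0 ≤ v ⬝ᵥ K.mulVec v) (hlam : 0 < lam)
    {q w : Fin n → ℝ} (h : (K + lam • (1 : Matrix (Fin n) (Fin n) ℝ)).mulVec q = w)
    {s : ℝ} (hw : ∀ j, |w j| ≤ s) (j : Fin n) : |q j| ≤ n / lam * s := by
  have : Nonempty (Fin n) := ⟨j⟩
  have hn : (0 : ℝ) < n := by exact_mod_cast (Nat.pos_of_ne_zero fun h => by subst h; exact j.elim0)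
  -- test the equation against `q` and bound everything by the largest entry of `q`
  obtain ⟨k, hk⟩ := Finite.exists_max fun j => |q j|
  have h1 : lam * (q ⬝ᵥ q) ≤ q ⬝ᵥ w := by
    rw [← h, Matrix.add_mulVec, dotProduct_add, Matrix.smul_mulVec, Matrix.one_mulVec,
      dotProduct_smul, smul_eq_mul]
    linarith [hK q]
  have h2 : q k ^ 2 ≤ q ⬝ᵥ q := by
    rw [dotProduct, pow_two]
    exact Finset.single_le_sum (f := fun i => q i * q i) (fun i _ => mul_self_nonneg _)
      (Finset.mem_univ k)
  have h3 : q ⬝ᵥ w ≤ n * (|q k| * s) := by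
    calc q ⬝ᵥ w ≤ ∑ _i : Fin n, |q k| * s := by
          refine Finset.sum_le_sum fun i _ => (le_abs_self _).trans ?_
          rw [abs_mul]
          exact mul_le_mul (hk i) (hw i) (abs_nonneg _) (abs_nonneg _)
      _ = n * (|q k| * s) := by simp
  have hs : 0 ≤ s := (abs_nonneg _).trans (hw j)
  refine (hk j).trans ?_
  rcases (abs_nonneg (q k)).eq_or_lt with h0 | h0
  · rw [← h0]; positivity
  · have h4 : lam * |q k| * |q k| ≤ n * s * |q k| := by
      have : |q k| * |q k| = q k ^ 2 := by rw [← pow_two, sq_abs]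
      nlinarith
    have h5 := le_of_mul_le_mul_right h4 h0
    rw [div_mul_eq_mul_div, le_div_iff₀ hlam]
    linarith

theorem isUnit_ridge (hK : ∀ v, 0 ≤ v ⬝ᵥ K.mulVec v) (hlam : 0 < lam) :
    IsUnit (K + lam • (1 : Matrix (Fin n) (Fin n) ℝ)) := by
  rw [← Matrix.mulVec_injective_iff_isUnit]
  intro u v huv
  have h0 : (K + lam • (1 : Matrix (Fin n) (Fin n) ℝ)).mulVec (u - v) = 0 := by
    rw [Matrix.mulVec_sub]; exact sub_eq_zero.mpr huv
  funext j
  have := abs_le_of_ridge_mulVec_eq hK hlam h0 (s := 0) (by simp) j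
  rw [mul_zero, abs_nonpos_iff] at this
  exact sub_eq_zero.mp this

theorem ridge_mulVec_inv (hK : ∀ v, 0 ≤ v ⬝ᵥ K.mulVec v) (hlam : 0 < lam) (w : Fin n → ℝ) :
    (K + lam • (1 : Matrix (Fin n) (Fin n) ℝ)).mulVec
      ((K + lam • (1 : Matrix (Fin n) (Fin n) ℝ))⁻¹.mulVec w) = w := by
  rw [Matrix.mulVec_mulVec, Matrix.mul_nonsing_inv _
    ((Matrix.isUnit_iff_isUnit_det _).mp (isUnit_ridge hK hlam)), Matrix.one_mulVec]

theorem abs_ridge_inv_le (hK : ∀ v, 0 ≤ v ⬝ᵥ K.mulVec v) (hlam : 0 < lam) {w : Fin n → ℝ}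
    {s : ℝ} (hw : ∀ j, |w j| ≤ s) (j : Fin n) :
    |(K + lam • (1 : Matrix (Fin n) (Fin n) ℝ))⁻¹.mulVec w j| ≤ n / lam * s :=
  abs_le_of_ridge_mulVec_eq hK hlam (ridge_mulVec_inv hK hlam w) hw j

theorem abs_dotProduct_le {k q : Fin n → ℝ} {s b : ℝ} (hk : ∀ j, |k j| ≤ s)
    (hq : ∀ j, |q j| ≤ b) : |k ⬝ᵥ q| ≤ n * (s * b) := by
  calc |k ⬝ᵥ q| ≤ ∑ j, |k j * q j| := Finset.abs_sum_le_sum_abs _ _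
    _ ≤ ∑ _j : Fin n, s * b := by
        refine Finset.sum_le_sum fun j _ => ?_
        rw [abs_mul]
        exact mul_le_mul (hk j) (hq j) (abs_nonneg _) ((abs_nonneg _).trans (hk j))
    _ = n * (s * b) := by simp

/-- Lipschitz dependence of the ridge predictor `k ↦ kᵀ (K + lam I)⁻¹ w` on the kernel. -/
theorem abs_dotProduct_ridge_inv_sub_le {K' : Matrix (Fin n) (Fin n) ℝ}
    (hK : ∀ v, 0 ≤ v ⬝ᵥ K.mulVec v) (hK' : ∀ v, 0 ≤ v ⬝ᵥ K'.mulVec v) (hlam : 0 < lam)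
    {k k' w : Fin n → ℝ} {η : ℝ} (hkk : ∀ j, |k j| ≤ 1) (hk : ∀ j, |k' j - k j| ≤ η)
    (hKK : ∀ j l, |K' j l - K j l| ≤ η) (hw : ∀ j, |w j| ≤ 1) :
    |k' ⬝ᵥ (K' + lam • (1 : Matrix (Fin n) (Fin n) ℝ))⁻¹.mulVec w
      - k ⬝ᵥ (K + lam • (1 : Matrix (Fin n) (Fin n) ℝ))⁻¹.mulVec w|
      ≤ η * (n * (n / lam) + (n * (n / lam)) ^ 2) := by
  set q := (K + lam • (1 : Matrix (Fin n) (Fin n) ℝ))⁻¹.mulVec w with hq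
  set q' := (K' + lam • (1 : Matrix (Fin n) (Fin n) ℝ))⁻¹.mulVec w with hq'
  have e : (K + lam • (1 : Matrix (Fin n) (Fin n) ℝ)).mulVec q = w := ridge_mulVec_inv hK hlam w
  have e' : (K' + lam • (1 : Matrix (Fin n) (Fin n) ℝ)).mulVec q' = w :=
    ridge_mulVec_inv hK' hlam w
  have bq : ∀ j, |q j| ≤ n / lam * 1 := abs_ridge_inv_le hK hlam hw
  have bq' : ∀ j, |q' j| ≤ n / lam * 1 := abs_ridge_inv_le hK' hlam hw
  -- resolvent identity
  have hd : (K' + lam • (1 : Matrix (Fin n) (Fin n) ℝ)).mulVec (q' - q) = (K - K').mulVec q := by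
    rw [Matrix.mulVec_sub, e', ← e, Matrix.add_mulVec, Matrix.add_mulVec, Matrix.sub_mulVec]
    abel
  have hd' : ∀ j, |(K - K').mulVec q j| ≤ n * (η * (n / lam * 1)) := fun j =>
    abs_dotProduct_le (k := fun l => (K - K') j l)
      (fun l => by rw [Matrix.sub_apply, abs_sub_comm]; exact hKK j l) bq
  have bd : ∀ j, |(q' - q) j| ≤ n / lam * (n * (η * (n / lam * 1))) :=
    abs_le_of_ridge_mulVec_eq hK' hlam hd hd'
  have h1 := abs_dotProduct_le (k := k' - k) hk bq'
  have h2 := abs_dotProduct_le hkk bd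
  have h3 : k' ⬝ᵥ q' - k ⬝ᵥ q = (k' - k) ⬝ᵥ q' + k ⬝ᵥ (q' - q) := by
    rw [sub_dotProduct, dotProduct_sub]; ring
  rw [h3]
  refine (abs_add_le _ _).trans ((add_le_add h1 h2).trans (le_of_eq ?_))
  ring

theorem dotProduct_gram_mulVec_nonneg {F : Type*} [NormedAddCommGroup F] [InnerProductSpace ℝ F]
    (g : Fin n → F) (v : Fin n → ℝ) :
    0 ≤ v ⬝ᵥ (Matrix.of fun j k => (inner ℝ (g j) (g k) : ℝ)).mulVec v := by
  have h : v ⬝ᵥ (Matrix.of fun j k => (inner ℝ (g j) (g k) : ℝ)).mulVec v =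
      inner ℝ (∑ j, v j • g j) (∑ j, v j • g j) := by
    simp only [dotProduct, Matrix.mulVec, Matrix.of_apply, sum_inner, inner_sum,
      real_inner_smul_left, real_inner_smul_right, Finset.mul_sum]
    exact Finset.sum_congr rfl fun j _ => Finset.sum_congr rfl fun k _ => by
      rw [real_inner_comm]; ring
  rw [h]
  exact real_inner_self_nonneg

end Ridge

/-! ### Activation patterns and the neural tangent kernel -/

section Ntk

variable {d : ℕ}

/-- The activation pattern `𝟙{wᵀ x ≥ 0}`, one choice of `σ'(wᵀ x)`. The value `1` at the kink
matches the convention of `ntk`. -/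
noncomputable def act (w x : E d) : ℝ := if 0 ≤ (inner ℝ w x : ℝ) then 1 else 0

theorem act_eq_zero_or_one (w x : E d) : act w x = 0 ∨ act w x = 1 := by
  unfold act; split_ifs <;> simp

theorem act_nonneg (w x : E d) : 0 ≤ act w x := by
  rcases act_eq_zero_or_one w x with h | h <;> simp [h]

theorem act_le_one (w x : E d) : act w x ≤ 1 := by
  rcases act_eq_zero_or_one w x with h | h <;> simp [h]

theorem measurable_act (x : E d) : Measurable fun w : E d => act w x :=
  Measurable.ite (measurableSet_le measurable_const (by fun_prop)) measurable_const
    measurable_const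

theorem act_mul_act_mul_inner_eq (w x x' : E d) :
    act w x * act w x' * inner ℝ x x' =
      if 0 ≤ (inner ℝ w x : ℝ) ∧ 0 ≤ (inner ℝ w x' : ℝ) then (inner ℝ x x' : ℝ) else 0 := by
  unfold act; split_ifs <;> simp_all

theorem ntk_eq_integral (x x' : E d) :
    ntk x x' = ∫ w, act w x * act w x' * inner ℝ x x' ∂(stdGaussian (E d)) := by
  simp only [ntk, act_mul_act_mul_inner_eq]

theorem abs_act_mul_act_mul_inner_le (w : E d) {x x' : E d} (hx : ‖x‖ = 1) (hx' : ‖x'‖ = 1) :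
    |act w x * act w x' * inner ℝ x x'| ≤ 1 := by
  have h : |inner ℝ x x'| ≤ 1 := by simpa [hx, hx'] using abs_real_inner_le_norm x x'
  rcases act_eq_zero_or_one w x with h1 | h1 <;> rcases act_eq_zero_or_one w x' with h2 | h2 <;>
    simp [h1, h2, h]

theorem measurable_act_mul_act_mul_inner (x x' : E d) :
    Measurable fun w : E d => act w x * act w x' * inner ℝ x x' :=
  ((measurable_act x).mul (measurable_act x')).mul_const _

theorem integrable_act_mul_act_mul_inner {x x' : E d} (hx : ‖x‖ = 1) (hx' : ‖x'‖ = 1) :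
    Integrable (fun w : E d => act w x * act w x' * inner ℝ x x') (stdGaussian (E d)) :=
  Integrable.of_bound (measurable_act_mul_act_mul_inner x x').aestronglyMeasurable 1
    (Eventually.of_forall fun w => abs_act_mul_act_mul_inner_le w hx hx')

theorem abs_ntk_le {x x' : E d} (hx : ‖x‖ = 1) (hx' : ‖x'‖ = 1) : |ntk x x'| ≤ 1 := by
  rw [ntk_eq_integral, ← Real.norm_eq_abs]
  refine (norm_integral_le_of_norm_le_const (C := 1) (Eventually.of_forall fun w => ?_)).trans
    (by simp)
  exact abs_act_mul_act_mul_inner_le w hx hx'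

theorem dotProduct_Ktr_mulVec_nonneg {n : ℕ} {X : Fin n → E d} (hX : ∀ j, ‖X j‖ = 1)
    (v : Fin n → ℝ) : 0 ≤ v ⬝ᵥ (Ktr X).mulVec v := by
  have h : v ⬝ᵥ (Ktr X).mulVec v = ∫ w, v ⬝ᵥ (Matrix.of fun j k =>
      (inner ℝ (act w (X j) • X j) (act w (X k) • X k) : ℝ)).mulVec v ∂(stdGaussian (E d)) := by
    have he : ∀ (w : E d) (j k : Fin n), (inner ℝ (act w (X j) • X j) (act w (X k) • X k) : ℝ) =
        act w (X j) * act w (X k) * inner ℝ (X j) (X k) := fun w j k => by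
      rw [real_inner_smul_left, real_inner_smul_right, mul_assoc]
    simp only [dotProduct, Matrix.mulVec, Matrix.of_apply, Ktr, ntk_eq_integral, he]
    have hi : ∀ j k, Integrable (fun w : E d =>
        act w (X j) * act w (X k) * inner ℝ (X j) (X k) * v k) (stdGaussian (E d)) := fun j k =>
      (integrable_act_mul_act_mul_inner (hX j) (hX k)).mul_const _
    rw [integral_finsetSum _ fun j _ => (integrable_finsetSum _ fun k _ => hi j k).const_mul _]
    refine Finset.sum_congr rfl fun j _ => ?_
    rw [integral_const_mul, integral_finsetSum _ fun k _ => hi j k]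
    simp only [integral_mul_const]
  rw [h]
  exact integral_nonneg fun w => dotProduct_gram_mulVec_nonneg _ v

end Ntk

/-! ### Quadratic losses in inner product spaces -/

section Quadratic

variable {F : Type*} [NormedAddCommGroup F] [InnerProductSpace ℝ F]

theorem gradient_half_sq_of_eventuallyEq [CompleteSpace F] {f : F → ℝ} {g w : F} {y : ℝ}
    (h : f =ᶠ[𝓝 w] fun v => (1 / 2) * ((inner ℝ g v : ℝ) - y) ^ 2) :
    gradient f w = ((inner ℝ g w : ℝ) - y) • g := by
  rw [h.gradient_eq]
  apply HasGradientAt.gradient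
  rw [hasGradientAt_iff_hasFDerivAt]
  have h1 : HasFDerivAt (fun v : F => (inner ℝ g v : ℝ)) (innerSL ℝ g) w :=
    (innerSL ℝ g).hasFDerivAt
  refine (((h1.sub_const y).pow 2).const_mul (1 / 2)).congr_fderiv ?_
  ext v
  simp
  ring

theorem fderiv_smul_of_eventuallyEq {f : F → F} {g w : F} {y : ℝ}
    (h : f =ᶠ[𝓝 w] fun v => ((inner ℝ g v : ℝ) - y) • g) (v : F) :
    fderiv ℝ f w v = (inner ℝ g v : ℝ) • g := by
  have h1 : HasFDerivAt (fun v : F => (inner ℝ g v : ℝ)) (innerSL ℝ g) w :=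
    (innerSL ℝ g).hasFDerivAt
  rw [h.fderiv_eq, ((h1.sub_const y).smul_const g).fderiv]
  simp

theorem isInvertible_of_apply_eq [FiniteDimensional ℝ F] {n : ℕ} {lam : ℝ} (hlam : 0 < lam)
    (g : Fin n → F) {T : F →L[ℝ] F}
    (hT : ∀ v, T v = ∑ j, (inner ℝ (g j) v : ℝ) • g j + lam • v) : T.IsInvertible := by
  have hinj : Function.Injective (T : F →ₗ[ℝ] F) := by
    rw [← LinearMap.ker_eq_bot, LinearMap.ker_eq_bot']
    intro v hv
    have h1 : (inner ℝ v (T v) : ℝ) = 0 := by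
      have : T v = 0 := hv
      rw [this, inner_zero_right]
    rw [hT, inner_add_right, inner_sum, real_inner_smul_right, real_inner_self_eq_norm_sq] at h1
    have h2 : 0 ≤ ∑ j, (inner ℝ v ((inner ℝ (g j) v : ℝ) • g j) : ℝ) :=
      Finset.sum_nonneg fun j _ => by
        rw [real_inner_smul_right, real_inner_comm]; exact mul_self_nonneg _
    have h3 : ‖v‖ ^ 2 = 0 := by
      have : 0 ≤ ‖v‖ ^ 2 := by positivity
      nlinarith
    simpa using h3
  refine ⟨(LinearEquiv.ofInjectiveEndo _ hinj).toContinuousLinearEquiv, ?_⟩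
  ext v : 1
  rfl

theorem dense_setOf_ne_zero {L : F →ₗ[ℝ] ℝ} (hL : L ≠ 0) : Dense {v | L v ≠ 0} := by
  have hi : interior ((LinearMap.ker L : Submodule ℝ F) : Set F) = ∅ := by
    by_contra hne
    exact hL (LinearMap.ker_eq_top.mp
      (Submodule.eq_top_of_nonempty_interior' _ (Set.nonempty_iff_ne_empty.mpr hne)))
  rw [interior_eq_empty_iff_dense_compl] at hi
  exact hi

end Quadratic

/-! ### The network at smooth weights -/

section Network

variable {d m : ℕ}

theorem mul_eq_relu_of_mem_reluSubdiff {s z : ℝ} (h : s ∈ reluSubdiff z) : s * z = relu z := by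
  unfold relu
  rcases lt_trichotomy z 0 with hz | hz | hz
  · rw [h.2.1 hz, max_eq_right hz.le, zero_mul]
  · simp [hz]
  · rw [h.1 hz, max_eq_left hz.le, one_mul]

theorem act_mem_reluSubdiff (w x : E d) : act w x ∈ reluSubdiff (inner ℝ w x : ℝ) := by
  refine ⟨fun h => if_pos h.le, fun h => if_neg (not_le.mpr h), act_nonneg w x, act_le_one w x⟩

/-- A preactivation that moves by less than its distance to the kink does not change its slope. -/
theorem eq_of_mem_reluSubdiff {s z : ℝ} (h : s ∈ reluSubdiff z) (x w : E d)
    (hz : |(inner ℝ w x : ℝ) - z| < |(inner ℝ w x : ℝ)|) : s = act w x := by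
  unfold act
  rcases le_or_gt 0 (inner ℝ w x : ℝ) with h0 | h0
  · rw [abs_of_nonneg h0] at hz
    rw [if_pos h0, h.1 (by linarith [(abs_lt.mp hz).2])]
  · rw [abs_of_neg h0] at hz
    rw [if_neg (not_le.mpr h0), h.2.1 (by linarith [(abs_lt.mp hz).1])]

/-- The gradient `∂f_nn(x; W)/∂W` when the slopes `σ'(w_rᵀ x)` are given the values `p r`. -/
noncomputable def feat (a p : Fin m → ℝ) (x : E d) : Params d m :=
  WithLp.toLp 2 fun r => ((1 / Real.sqrt m) * a r * p r) • x

/-- The gradient `∂f_nn(x; W)/∂W` with the slopes given by the activation pattern at `W`. -/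
noncomputable def actFeat (a : Fin m → ℝ) (W : Params d m) (x : E d) : Params d m :=
  feat a (fun r => act (W r) x) x

theorem inner_feat (a p : Fin m → ℝ) (x : E d) (W : Params d m) :
    (inner ℝ (feat a p x) W : ℝ) = (1 / Real.sqrt m) * ∑ r, a r * (p r * inner ℝ (W r) x) := by
  rw [PiLp.inner_apply, Finset.mul_sum]
  refine Finset.sum_congr rfl fun r _ => ?_
  rw [feat, real_inner_smul_left, real_inner_comm]
  ring

theorem net_eq_inner_feat (a : Fin m → ℝ) {p : Fin m → ℝ} {x : E d} {W : Params d m}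
    (hp : ∀ r, p r ∈ reluSubdiff (inner ℝ (W r) x : ℝ)) :
    net a W x = inner ℝ (feat a p x) W := by
  simp only [inner_feat, net, fun r => mul_eq_relu_of_mem_reluSubdiff (hp r)]

theorem net_eq_inner_actFeat (a : Fin m → ℝ) (W : Params d m) (x : E d) :
    net a W x = inner ℝ (actFeat a W x) W :=
  net_eq_inner_feat a fun r => act_mem_reluSubdiff (W r) x

theorem inner_feat_feat {a : Fin m → ℝ} (ha : ∀ r, a r ^ 2 = 1) (p q : Fin m → ℝ) (x x' : E d) :
    (inner ℝ (feat a p x) (feat a q x') : ℝ) = (1 / m) * ∑ r, p r * q r * inner ℝ x x' := by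
  rw [PiLp.inner_apply, Finset.mul_sum]
  refine Finset.sum_congr rfl fun r _ => ?_
  have h : (1 / Real.sqrt m) * (1 / Real.sqrt m) = 1 / (m : ℝ) := by
    rw [div_mul_div_comm, one_mul, Real.mul_self_sqrt (Nat.cast_nonneg m)]
  simp only [feat, real_inner_smul_left, real_inner_smul_right]
  calc _ = ((1 / Real.sqrt m) * (1 / Real.sqrt m)) * (a r ^ 2) * (p r * q r * inner ℝ x x') := by
        ring
    _ = _ := by rw [h, ha r, mul_one]

theorem norm_feat_sq {a : Fin m → ℝ} (ha : ∀ r, a r ^ 2 = 1) (p : Fin m → ℝ) {x : E d}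
    (hx : ‖x‖ = 1) : ‖feat a p x‖ ^ 2 = (1 / m) * ∑ r, p r ^ 2 := by
  rw [← real_inner_self_eq_norm_sq, inner_feat_feat ha, real_inner_self_eq_norm_sq, hx]
  simp [pow_two]

theorem norm_feat_le_one {a : Fin m → ℝ} (ha : ∀ r, a r ^ 2 = 1) {p : Fin m → ℝ} {x : E d}
    (hx : ‖x‖ = 1) (hp : ∀ r, p r ∈ Set.Icc (0 : ℝ) 1) : ‖feat a p x‖ ≤ 1 := by
  refine (sq_le_one_iff₀ (norm_nonneg _)).mp ?_
  rw [norm_feat_sq ha p hx]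
  have h : ∑ r, p r ^ 2 ≤ m := by
    calc ∑ r, p r ^ 2 ≤ ∑ _r : Fin m, (1 : ℝ) :=
          Finset.sum_le_sum fun r _ => pow_le_one₀ (hp r).1 (hp r).2
      _ = m := by simp
  calc 1 / (m : ℝ) * ∑ r, p r ^ 2 ≤ 1 / m * m := by gcongr
    _ ≤ 1 := by rw [one_div]; exact inv_mul_le_one

theorem norm_actFeat_le_one {a : Fin m → ℝ} (ha : ∀ r, a r ^ 2 = 1) (W : Params d m) {x : E d}
    (hx : ‖x‖ = 1) : ‖actFeat a W x‖ ≤ 1 :=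
  norm_feat_le_one ha hx fun _ => ⟨act_nonneg _ _, act_le_one _ _⟩

theorem feat_sub (a p q : Fin m → ℝ) (x : E d) :
    feat a p x - feat a q x = feat a (fun r => p r - q r) x := by
  ext r : 1
  simp only [feat, PiLp.sub_apply, mul_sub, sub_smul]

theorem eventually_actFeat_eq (a : Fin m → ℝ) {W : Params d m} {x : E d}
    (hW : ∀ r, (inner ℝ (W r) x : ℝ) ≠ 0) : ∀ᶠ W' in 𝓝 W, actFeat a W' x = actFeat a W x := by
  have h : ∀ r, ∀ᶠ W' : Params d m in 𝓝 W, act (W' r) x = act (W r) x := by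
    intro r
    have hc : Continuous fun W' : Params d m => (inner ℝ (W' r) x : ℝ) :=
      (PiLp.continuous_apply 2 _ r).inner continuous_const
    rcases (hW r).lt_or_gt with h0 | h0
    · filter_upwards [hc.continuousAt.eventually_lt continuousAt_const h0] with W' hW'
      rw [act, act, if_neg (not_le.mpr hW'), if_neg (not_le.mpr h0)]
    · filter_upwards [continuousAt_const.eventually_lt hc.continuousAt h0] with W' hW'
      rw [act, act, if_pos hW'.le, if_pos h0.le]
  filter_upwards [eventually_all.mpr h] with W' hW'
  simp only [actFeat, hW']

theorem gradient_loss (a : Fin m → ℝ) {W : Params d m} {x : E d} (y : ℝ)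
    (hW : ∀ r, (inner ℝ (W r) x : ℝ) ≠ 0) :
    gradient (loss a x y) W = (net a W x - y) • actFeat a W x := by
  have h : loss a x y =ᶠ[𝓝 W]
      fun W' => (1 / 2) * ((inner ℝ (actFeat a W x) W' : ℝ) - y) ^ 2 := by
    filter_upwards [eventually_actFeat_eq a hW] with W' hW'
    rw [loss, net_eq_inner_actFeat, hW']
  rw [gradient_half_sq_of_eventuallyEq h, net_eq_inner_actFeat]

theorem fderiv_gradient_loss (a : Fin m → ℝ) {W : Params d m} {x : E d} (y : ℝ)
    (hW : ∀ r, (inner ℝ (W r) x : ℝ) ≠ 0) (v : Params d m) :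
    fderiv ℝ (gradient (loss a x y)) W v = (inner ℝ (actFeat a W x) v : ℝ) • actFeat a W x := by
  have hs : ∀ᶠ W' : Params d m in 𝓝 W, ∀ r, (inner ℝ (W' r) x : ℝ) ≠ 0 := by
    refine eventually_all.mpr fun r => ?_
    have hc : Continuous fun W' : Params d m => (inner ℝ (W' r) x : ℝ) :=
      (PiLp.continuous_apply 2 _ r).inner continuous_const
    exact hc.continuousAt.eventually_ne (hW r)
  have h : gradient (loss a x y) =ᶠ[𝓝 W]
      fun W' => ((inner ℝ (actFeat a W x) W' : ℝ) - y) • actFeat a W x := by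
    filter_upwards [eventually_actFeat_eq a hW, hs] with W' h1 h2
    rw [gradient_loss a y h2, net_eq_inner_actFeat, h1]
  exact fderiv_smul_of_eventuallyEq h v

variable {n : ℕ}

theorem hessian_apply (lam : ℝ) {X : Fin n → E d} (Y : Fin n → ℝ) (a : Fin m → ℝ)
    {W : Params d m} {xte : E d} (hW : W ∈ smoothWeights m X xte) (v : Params d m) :
    hessian lam X Y a W v =
      ∑ j, (inner ℝ (actFeat a W (X j)) v : ℝ) • actFeat a W (X j) + lam • v := by
  simp only [hessian, add_apply, sum_apply, smul_apply, ContinuousLinearMap.id_apply]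
  congr 1
  exact Finset.sum_congr rfl fun j _ => fderiv_gradient_loss a (Y j) (fun r => (hW r).2 j) v

theorem hessian_isInvertible {lam : ℝ} (hlam : 0 < lam) {X : Fin n → E d} (Y : Fin n → ℝ)
    (a : Fin m → ℝ) {W : Params d m} {xte : E d} (hW : W ∈ smoothWeights m X xte) :
    (hessian lam X Y a W).IsInvertible :=
  isInvertible_of_apply_eq hlam (fun j => actFeat a W (X j)) (hessian_apply lam Y a hW)

/-- Push-through identity: `H⁻¹ g_i` is a combination of the features `g_k`, with coefficients
`(K + lam I)⁻¹ e_i`. -/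
theorem ihvpAt_eq {lam : ℝ} (hlam : 0 < lam) (X : Fin n → E d) (Y : Fin n → ℝ) (xte : E d)
    (yte : ℝ) (i : Fin n) (a : Fin m → ℝ) {W : Params d m} (hW : W ∈ smoothWeights m X xte) :
    ihvpAt lam X Y xte yte i a W =
      ((fun j => inner ℝ (actFeat a W xte) (actFeat a W (X j))) ⬝ᵥ
        (((Matrix.of fun j k => (inner ℝ (actFeat a W (X j)) (actFeat a W (X k)) : ℝ)) +
          lam • (1 : Matrix (Fin n) (Fin n) ℝ))⁻¹.mulVec (Pi.single i 1))) *
        (net a W xte - yte) * (net a W (X i) - Y i) := by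
  set g := fun j => actFeat a W (X j) with hg
  set K : Matrix (Fin n) (Fin n) ℝ := Matrix.of fun j k => (inner ℝ (g j) (g k) : ℝ) with hK
  set q := (K + lam • (1 : Matrix (Fin n) (Fin n) ℝ))⁻¹.mulVec (Pi.single i 1) with hq
  have hKq : (K + lam • (1 : Matrix (Fin n) (Fin n) ℝ)).mulVec q = Pi.single i 1 :=
    ridge_mulVec_inv (dotProduct_gram_mulVec_nonneg g) hlam _
  have hsol : g i = hessian lam X Y a W (∑ k, q k • g k) := by
    rw [hessian_apply lam Y a hW, Finset.smul_sum, ← Finset.sum_add_distrib]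
    have h1 : ∀ j, (inner ℝ (g j) (∑ k, q k • g k) : ℝ) • g j + lam • q j • g j =
        (Pi.single i (1 : ℝ) : Fin n → ℝ) j • g j := by
      intro j
      rw [← hKq, Matrix.add_mulVec, Matrix.smul_mulVec, Matrix.one_mulVec, smul_smul, ← add_smul]
      congr 2
      simp only [inner_sum, real_inner_smul_right, Matrix.mulVec, dotProduct, hK, Matrix.of_apply]
      exact Finset.sum_congr rfl fun k _ => mul_comm _ _
    rw [Finset.sum_congr rfl fun j _ => h1 j, Finset.sum_eq_single i]
    · simp
    · intro j _ hj; simp [hj]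
    · simp
  have hinv : (hessian lam X Y a W).inverse (g i) = ∑ k, q k • g k :=
    (hessian_isInvertible hlam Y a hW).inverse_apply_eq.mpr hsol
  rw [ihvpAt, gradient_loss a yte fun r => (hW r).1, gradient_loss a (Y i) fun r => (hW r).2 i,
    map_smul]
  change inner ℝ _ ((net a W (X i) - Y i) • (hessian lam X Y a W).inverse (g i)) = _
  rw [hinv, real_inner_smul_left, real_inner_smul_right, inner_sum]
  simp only [real_inner_smul_right, dotProduct, mul_comm (q _)]
  ring

theorem dense_smoothWeights {X : Fin n → E d} {xte : E d} (hX : ∀ j, X j ≠ 0) (hxte : xte ≠ 0) :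
    Dense (smoothWeights m X xte) := by
  have hpt : ∀ (r : Fin m) (x : E d), x ≠ 0 →
      IsOpen {W : Params d m | (inner ℝ (W r) x : ℝ) ≠ 0} ∧
        Dense {W : Params d m | (inner ℝ (W r) x : ℝ) ≠ 0} := by
    intro r x hx
    have hc : Continuous fun W' : Params d m => (inner ℝ (W' r) x : ℝ) :=
      (PiLp.continuous_apply 2 _ r).inner continuous_const
    refine ⟨isOpen_ne.preimage hc, ?_⟩
    let L : Params d m →ₗ[ℝ] ℝ :=
      { toFun := fun W => inner ℝ (W r) x
        map_add' := fun W W' => by rw [PiLp.add_apply, inner_add_left]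
        map_smul' := fun c W => by rw [PiLp.smul_apply, real_inner_smul_left]; rfl }
    refine dense_setOf_ne_zero (L := L) fun h => hx ?_
    have : L (WithLp.toLp 2 fun _ => x) = 0 := by rw [h, LinearMap.zero_apply]
    exact inner_self_eq_zero (𝕜 := ℝ).mp this
  have heq : smoothWeights m X xte =
      ⋂ z : Fin m × Option (Fin n), {W | (inner ℝ (W z.1) (z.2.elim xte X) : ℝ) ≠ 0} := by
    ext W
    simp only [smoothWeights, Set.mem_ofPred_eq, Set.mem_iInter, Prod.forall, Option.forall,
      Option.elim]
  have hne : ∀ o : Option (Fin n), o.elim xte X ≠ 0 := by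
    rintro (_ | j)
    exacts [hxte, hX j]
  rw [heq]
  exact dense_iInter_of_isOpen (fun z => (hpt z.1 _ (hne z.2)).1) fun z => (hpt z.1 _ (hne z.2)).2

end Network

/-! ### Lazy training from a good initialization -/

section Lazy

variable {d m n : ℕ}

/-- Initial signs `a` and weights `W0` from which training is lazy. The index `z : Option (Fin n)`
runs over the training points and the test point (`none`). A neuron is counted in `card_le` if its
displacement could bring it to the kink at the point in question. -/
structure GoodInit (X : Fin n → E d) (xte : E d) (η R : ℝ) (a : Fin m → ℝ) (W0 : Params d m) :
    Prop where
  sq_eq_one : ∀ r, a r ^ 2 = 1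
  abs_net_le : ∀ z : Option (Fin n), |net a W0 (z.elim xte X)| ≤ η
  abs_kernel_sub_le : ∀ (z : Option (Fin n)) (k : Fin n),
    |(inner ℝ (actFeat a W0 (z.elim xte X)) (actFeat a W0 (X k)) : ℝ) -
      ntk (z.elim xte X) (X k)| ≤ η
  card_le : ∀ W : Params d m, ‖W - W0‖ ≤ R → ∀ z : Option (Fin n),
    ((Finset.univ.filter fun r => |(inner ℝ (W0 r) (z.elim xte X) : ℝ)| ≤ ‖W r - W0 r‖).card : ℝ)
      ≤ η ^ 2 * m

/-- A feature with slopes supported on few neurons is small. -/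
theorem norm_feat_le_of_card_le {a : Fin m → ℝ} (ha : ∀ r, a r ^ 2 = 1) {p : Fin m → ℝ} {x : E d}
    (hx : ‖x‖ = 1) (hp : ∀ r, |p r| ≤ 1) {S : Finset (Fin m)} (hS : ∀ r, r ∉ S → p r = 0)
    {η : ℝ} (hη : 0 ≤ η) (hcard : (S.card : ℝ) ≤ η ^ 2 * m) : ‖feat a p x‖ ≤ η := by
  refine le_of_sq_le_sq ?_ hη
  rw [norm_feat_sq ha p hx]
  have h : ∑ r, p r ^ 2 ≤ η ^ 2 * m := by
    refine le_trans ?_ hcard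
    rw [← Finset.sum_subset (Finset.subset_univ S) fun r _ hr => by rw [hS r hr]; simp]
    calc ∑ r ∈ S, p r ^ 2 ≤ ∑ _r ∈ S, (1 : ℝ) :=
          Finset.sum_le_sum fun r _ => (sq_le_one_iff_abs_le_one _).mpr (hp r)
      _ = S.card := by simp
  calc 1 / (m : ℝ) * ∑ r, p r ^ 2 ≤ 1 / m * (η ^ 2 * m) := by gcongr
    _ = η ^ 2 * ((m : ℝ)⁻¹ * m) := by ring
    _ ≤ η ^ 2 := mul_le_of_le_one_right (sq_nonneg η) inv_mul_le_one

theorem abs_inner_sub_inner_le (v w : E d) {x : E d} (hx : ‖x‖ = 1) :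
    |(inner ℝ w x : ℝ) - inner ℝ v x| ≤ ‖v - w‖ := by
  rw [← inner_sub_left, norm_sub_rev]
  simpa [hx] using abs_real_inner_le_norm (w - v) x

theorem norm_feat_sub_actFeat_le {a : Fin m → ℝ} (ha : ∀ r, a r ^ 2 = 1) {W W0 : Params d m}
    {x : E d} (hx : ‖x‖ = 1) {p : Fin m → ℝ} (hp : ∀ r, p r ∈ reluSubdiff (inner ℝ (W r) x : ℝ))
    {η : ℝ} (hη : 0 ≤ η)
    (hcard : ((Finset.univ.filter fun r => |(inner ℝ (W0 r) x : ℝ)| ≤ ‖W r - W0 r‖).card : ℝ)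
      ≤ η ^ 2 * m) : ‖feat a p x - actFeat a W0 x‖ ≤ η := by
  rw [actFeat, feat_sub]
  refine norm_feat_le_of_card_le ha hx (fun r => ?_) (fun r hr => ?_) hη hcard
  · rw [abs_le]
    constructor <;>
      linarith [(hp r).2.2.1, (hp r).2.2.2, act_nonneg (W0 r) x, act_le_one (W0 r) x]
  · simp only [Finset.mem_filter, Finset.mem_univ, true_and, not_le] at hr
    exact sub_eq_zero.mpr
      (eq_of_mem_reluSubdiff (hp r) x (W0 r) ((abs_inner_sub_inner_le _ _ hx).trans_lt hr))

theorem abs_relu_sub_act_mul_le (z : ℝ) (w x : E d) :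
    |relu z - act w x * z| ≤ |z - inner ℝ w x| := by
  unfold relu act
  rcases le_total 0 z with hz | hz
  · rw [max_eq_left hz]
    split_ifs with h
    · simp
    · rw [zero_mul, sub_zero]
      exact abs_le_abs (by linarith) (by linarith)
  · rw [max_eq_right hz]
    split_ifs with h
    · rw [one_mul, zero_sub, abs_neg, abs_of_nonpos hz, abs_of_nonpos (by linarith)]
      linarith
    · simp

/-- The linearization error of the network is carried by the neurons that may have switched, and
there it is at most the displacement of the preactivation. -/
theorem abs_net_sub_inner_actFeat_le {a : Fin m → ℝ} (ha : ∀ r, a r ^ 2 = 1) {W W0 : Params d m}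
    {x : E d} (hx : ‖x‖ = 1) {η : ℝ} (hη : 0 ≤ η)
    (hcard : ((Finset.univ.filter fun r => |(inner ℝ (W0 r) x : ℝ)| ≤ ‖W r - W0 r‖).card : ℝ)
      ≤ η ^ 2 * m) : |net a W x - inner ℝ (actFeat a W0 x) W| ≤ η * ‖W - W0‖ := by
  -- `θ r` is the slope that accounts for the error `e r`; where both preactivations agree, `e r = 0`
  -- and the quotient is the harmless `0 / 0 = 0`
  set e : Fin m → ℝ := fun r => relu (inner ℝ (W r) x) - act (W0 r) x * inner ℝ (W r) x with he
  set θ : Fin m → ℝ := fun r => e r / ((inner ℝ (W r) x : ℝ) - inner ℝ (W0 r) x) with hθ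
  have hle : ∀ r, |e r| ≤ |(inner ℝ (W r) x : ℝ) - inner ℝ (W0 r) x| := fun r =>
    abs_relu_sub_act_mul_le _ _ _
  have hmul : ∀ r, θ r * ((inner ℝ (W r) x : ℝ) - inner ℝ (W0 r) x) = e r := by
    intro r
    refine div_mul_cancel_of_imp fun h => ?_
    have := hle r
    rwa [h, abs_zero, abs_nonpos_iff] at this
  have hnet : net a W x - inner ℝ (actFeat a W0 x) W = inner ℝ (feat a θ x) (W - W0) := by
    rw [actFeat, inner_feat, inner_feat, net, ← mul_sub, ← Finset.sum_sub_distrib]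
    congr 1
    refine Finset.sum_congr rfl fun r _ => ?_
    rw [← mul_sub, PiLp.sub_apply, inner_sub_left, hmul]
  have hnorm : ‖feat a θ x‖ ≤ η := by
    refine norm_feat_le_of_card_le ha hx (fun r => ?_) (fun r hr => ?_) hη hcard
    · rw [hθ, abs_div]
      exact div_le_one_of_le₀ (hle r) (abs_nonneg _)
    · simp only [Finset.mem_filter, Finset.mem_univ, true_and, not_le] at hr
      have h := eq_of_mem_reluSubdiff (act_mem_reluSubdiff (W r) x) x (W0 r)
        ((abs_inner_sub_inner_le _ _ hx).trans_lt hr)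
      have h' := mul_eq_relu_of_mem_reluSubdiff (act_mem_reluSubdiff (W r) x)
      rw [h] at h'
      simp only [hθ, he, h', sub_self, zero_div]
  rw [hnet]
  exact (abs_real_inner_le_norm _ _).trans (by gcongr)

variable {X : Fin n → E d} {xte : E d} {η R : ℝ} {a : Fin m → ℝ} {W0 : Params d m}

/-- The weights `W0 + ∑ k, c k • g_k`, with `g_k` the initial features. For
`c = (K^∞ + lam I)⁻¹ Y` they are the approximate end of training. -/
noncomputable def ridgeWeights (X : Fin n → E d) (a : Fin m → ℝ) (W0 : Params d m)
    (c : Fin n → ℝ) : Params d m :=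
  W0 + ∑ k, c k • actFeat a W0 (X k)

theorem norm_elim_eq_one (hX : ∀ j, ‖X j‖ = 1) (hxte : ‖xte‖ = 1) (z : Option (Fin n)) :
    ‖z.elim xte X‖ = 1 := by
  cases z <;> simp [hX, hxte]

theorem norm_ridgeWeights_sub_le (ha : ∀ r, a r ^ 2 = 1) (hX : ∀ j, ‖X j‖ = 1) {c : Fin n → ℝ}
    {B : ℝ} (hc : ∀ k, |c k| ≤ B) : ‖ridgeWeights X a W0 c - W0‖ ≤ n * B := by
  rw [ridgeWeights, add_sub_cancel_left]
  calc ‖∑ k, c k • actFeat a W0 (X k)‖ ≤ ∑ _k : Fin n, B := by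
        refine norm_sum_le_of_le _ fun k _ => ?_
        rw [norm_smul, Real.norm_eq_abs]
        exact (mul_le_of_le_one_right (abs_nonneg _) (norm_actFeat_le_one ha W0 (hX k))).trans
          (hc k)
    _ = n * B := by simp

theorem GoodInit.abs_net_sub_le (hG : GoodInit X xte η R a W0) (hη : 0 ≤ η)
    (hX : ∀ j, ‖X j‖ = 1) (hxte : ‖xte‖ = 1) {c : Fin n → ℝ} {B : ℝ} (hc : ∀ k, |c k| ≤ B)
    {W : Params d m} (hW : ‖W - W0‖ ≤ R) (z : Option (Fin n)) :
    |net a W (z.elim xte X) - Kte X (z.elim xte X) ⬝ᵥ c -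
      inner ℝ (actFeat a W0 (z.elim xte X)) (W - ridgeWeights X a W0 c)|
      ≤ η * (n * B + 1 + R) := by
  have hz := norm_elim_eq_one hX hxte z
  set x := z.elim xte X with hx
  have h1 := abs_net_sub_inner_actFeat_le hG.sq_eq_one hz hη (hG.card_le W hW z)
  have h2 := hG.abs_net_le z
  have h3 : |(fun k => (inner ℝ (actFeat a W0 x) (actFeat a W0 (X k)) : ℝ) - ntk x (X k)) ⬝ᵥ c|
      ≤ n * (η * B) := abs_dotProduct_le (hG.abs_kernel_sub_le z) hc
  have h4 : net a W x - Kte X x ⬝ᵥ c -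
      inner ℝ (actFeat a W0 x) (W - ridgeWeights X a W0 c) =
      (net a W x - inner ℝ (actFeat a W0 x) W) + net a W0 x +
        (fun k => (inner ℝ (actFeat a W0 x) (actFeat a W0 (X k)) : ℝ) - ntk x (X k)) ⬝ᵥ c := by
    have : (fun k => (inner ℝ (actFeat a W0 x) (actFeat a W0 (X k)) : ℝ) - ntk x (X k)) ⬝ᵥ c =
        (inner ℝ (actFeat a W0 x) (∑ k, c k • actFeat a W0 (X k)) : ℝ) - Kte X x ⬝ᵥ c := by
      simp only [inner_sum, real_inner_smul_right, dotProduct, Kte, ← Finset.sum_sub_distrib]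
      exact Finset.sum_congr rfl fun k _ => by ring
    rw [this, ridgeWeights, inner_sub_right, inner_add_right, net_eq_inner_actFeat a W0]
    ring
  rw [h4]
  have h5 : η * ‖W - W0‖ ≤ η * R := by gcongr
  calc _ ≤ η * ‖W - W0‖ + η + n * (η * B) :=
        (abs_add_le _ _).trans (add_le_add ((abs_add_le _ _).trans (add_le_add h1 h2)) h3)
    _ ≤ η * (n * B + 1 + R) := by linarith

/-- The velocity of the flow points towards the ridge weights, up to an error of order `η`. -/
theorem GoodInit.inner_velocity_le (hG : GoodInit X xte η R a W0) (hη : 0 ≤ η) (hη1 : η ≤ 1)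
    (hR : 0 ≤ R) (hX : ∀ j, ‖X j‖ = 1) (hxte : ‖xte‖ = 1) {lam : ℝ} (hlam : 0 < lam)
    {Y c : Fin n → ℝ} (hc : ∀ k, |c k| ≤ n / lam)
    (hcY : (Ktr X + lam • (1 : Matrix (Fin n) (Fin n) ℝ)).mulVec c = Y)
    {W V : Params d m} (hW : ‖W - W0‖ ≤ R) {ρ : ℝ} (hρ : ‖W - ridgeWeights X a W0 c‖ ≤ ρ)
    {s : Fin m → Fin n → ℝ} (hs : ∀ r j, s r j ∈ reluSubdiff (inner ℝ (W r) (X j) : ℝ))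
    (hV : ∀ r, V r = (∑ j, ((Y j - net a W (X j)) * ((1 / Real.sqrt m) * a r * s r j)) • X j)
            - lam • (W r - W0 r)) :
    inner ℝ (W - ridgeWeights X a W0 c) V ≤ -lam * ‖W - ridgeWeights X a W0 c‖ ^ 2 +
      η * (n * (2 * (n * (n / lam) + 1 + R) + n + ρ)) * ‖W - ridgeWeights X a W0 c‖ := by
  set D := W - ridgeWeights X a W0 c with hD
  set M := (n : ℝ) * (n / lam) + 1 + R with hM
  have hM0 : 0 ≤ M := by positivity
  set g0 : Fin n → Params d m := fun j => actFeat a W0 (X j) with hg0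
  set g : Fin n → Params d m := fun j => feat a (fun r => s r j) (X j) with hg
  have hVeq : V = ∑ j, (Y j - net a W (X j)) • g j - lam • (D + ∑ k, c k • g0 k) := by
    have h1 : D + ∑ k, c k • g0 k = W - W0 := by rw [hD, ridgeWeights]; abel
    rw [h1]
    ext r : 1
    simp only [hV r, PiLp.sub_apply, PiLp.smul_apply, WithLp.ofLp_sum, Finset.sum_apply, hg, feat,
      smul_smul]
  have hterm : ∀ j, (Y j - net a W (X j)) * (inner ℝ D (g j) : ℝ) - lam * (c j * inner ℝ D (g0 j))
      ≤ η * (2 * M + n + ρ) * ‖D‖ := by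
    intro j
    set u : ℝ := inner ℝ (g0 j) D with hu
    set v : ℝ := inner ℝ D (g j - g0 j) with hv
    set h : ℝ := net a W (X j) - Kte X (X j) ⬝ᵥ c - u with hh
    have hhle : |h| ≤ η * M := hG.abs_net_sub_le hη hX hxte hc hW (some j)
    have hule : |u| ≤ ‖D‖ := (abs_real_inner_le_norm _ _).trans
      (mul_le_of_le_one_left (norm_nonneg _) (norm_actFeat_le_one hG.sq_eq_one W0 (hX j)))
    have hvle : |v| ≤ η * ‖D‖ := by
      refine (abs_real_inner_le_norm _ _).trans ?_
      rw [mul_comm]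
      gcongr
      exact norm_feat_sub_actFeat_le hG.sq_eq_one (hX j) (fun r => hs r j) hη
        (hG.card_le W hW (some j))
    have hY : Y j = Kte X (X j) ⬝ᵥ c + lam * c j := by
      rw [← hcY, Matrix.add_mulVec, Matrix.smul_mulVec, Matrix.one_mulVec]
      rfl
    have hlc : |lam * c j| ≤ n := by
      rw [abs_mul, abs_of_pos hlam]
      calc lam * |c j| ≤ lam * (n / lam) := by gcongr; exact hc j
        _ = n := by field_simp
    have huD : (inner ℝ D (g0 j) : ℝ) = u := real_inner_comm _ _
    have hgj : (inner ℝ D (g j) : ℝ) = u + v := by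
      rw [hv, inner_sub_right, huD]; ring
    -- `Y j - net = lam c_j - u - h`, so the quadratic form of the linearized objective appears
    have heq : (Y j - net a W (X j)) * (inner ℝ D (g j) : ℝ) - lam * (c j * inner ℝ D (g0 j)) =
        -u ^ 2 + -h * u + (lam * c j - u - h) * v := by
      rw [hgj, hY, huD]
      have : net a W (X j) = h + Kte X (X j) ⬝ᵥ c + u := by rw [hh]; ring
      rw [this]; ring
    rw [heq]
    have h1 : -h * u ≤ η * M * ‖D‖ := by
      refine (le_abs_self _).trans ?_
      rw [abs_mul, abs_neg]
      gcongr
    have h2 : (lam * c j - u - h) * v ≤ (n + ρ + M) * (η * ‖D‖) := by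
      refine (le_abs_self _).trans ?_
      rw [abs_mul]
      have h3 : |lam * c j - u - h| ≤ n + ρ + M := by
        have h4 : η * M ≤ M := mul_le_of_le_one_left hM0 hη1
        have := (abs_sub _ _).trans (add_le_add_left (abs_sub (lam * c j) u) |h|)
        linarith
      exact mul_le_mul h3 hvle (abs_nonneg _) ((abs_nonneg _).trans h3)
    nlinarith [sq_nonneg u]
  have hsum : (inner ℝ D V : ℝ) = -lam * ‖D‖ ^ 2 +
      ∑ j, ((Y j - net a W (X j)) * (inner ℝ D (g j) : ℝ) - lam * (c j * inner ℝ D (g0 j))) := by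
    rw [hVeq, inner_sub_right, real_inner_smul_right, inner_add_right, real_inner_self_eq_norm_sq,
      inner_sum, inner_sum, Finset.sum_sub_distrib, ← Finset.mul_sum]
    simp only [real_inner_smul_right]
    ring
  rw [hsum]
  have hle := Finset.sum_le_sum fun j (_ : j ∈ Finset.univ) => hterm j
  simp only [Finset.sum_const, Finset.card_univ, Fintype.card_fin, nsmul_eq_mul] at hle
  linarith

end Lazy

/-! ### The end of training -/

section Conclusion

variable {d m n : ℕ} {X : Fin n → E d} {xte : E d} {η R : ℝ} {a : Fin m → ℝ} {W0 : Params d m}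

/-- The distance of the trajectory to the ridge weights decays exponentially down to order `η`. -/
theorem GoodInit.norm_sq_flow_sub_le (hG : GoodInit X xte η R a W0) (hη : 0 ≤ η) (hη1 : η ≤ 1)
    (hX : ∀ j, ‖X j‖ = 1) (hxte : ‖xte‖ = 1) {lam : ℝ} (hlam : 0 < lam)
    {Y c : Fin n → ℝ} (hc : ∀ k, |c k| ≤ n / lam)
    (hcY : (Ktr X + lam • (1 : Matrix (Fin n) (Fin n) ℝ)).mulVec c = Y)
    {W : ℝ → Params d m} (hW : IsGradientFlow lam X Y a W0 W)
    (hR : 2 * (n * (n / lam)) + 1 ≤ R) {C : ℝ}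
    (hC : C = n * (2 * (n * (n / lam) + 1 + R) + n + (n * (n / lam) + 1)))
    (hηC : η * C / lam < 1) {T : ℝ} (hT : 0 ≤ T) :
    ‖W T - ridgeWeights X a W0 c‖ ^ 2 ≤
      Real.exp (-lam * T) * (n * (n / lam)) ^ 2 + (η * C / lam) ^ 2 := by
  obtain ⟨V, hVint, hVW, hV⟩ := hW
  set b : ℝ := n * (n / lam) with hb
  have hb0 : 0 ≤ b := by positivity
  have hR0 : 0 ≤ R := by linarith
  have hC0 : 0 ≤ C := by rw [hC]; positivity
  set D₀ := W0 - ridgeWeights X a W0 c with hD₀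
  have hD₀le : ‖D₀‖ ≤ b := by
    rw [hD₀, norm_sub_rev]; exact norm_ridgeWeights_sub_le hG.sq_eq_one hX hc
  have hD : ∀ t, 0 ≤ t → D₀ + ∫ s in (0 : ℝ)..t, V s = W t - ridgeWeights X a W0 c := by
    intro t ht
    rw [hVW t ht, hD₀]; abel
  have hsq : ‖D₀‖ ^ 2 ≤ b ^ 2 := by gcongr
  have h := norm_sq_le_of_inner_le_on_ball (β := η * C) hlam hVint (D₀ := D₀) rfl
    (R := b + 1) (by linarith) ?_ ?_ hT
  · simp only [hD T hT] at h
    refine h.trans ?_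
    gcongr
  · have h0 : 0 ≤ η * C / lam := by positivity
    nlinarith
  · rw [ae_restrict_iff' measurableSet_Ici] at hV ⊢
    filter_upwards [hV] with t ht ht0 hball
    obtain ⟨s, hs, hVs⟩ := ht ht0
    rw [hD t ht0] at hball ⊢
    have hWR : ‖W t - W0‖ ≤ R := by
      have : W t - W0 = (W t - ridgeWeights X a W0 c) + -D₀ := by rw [hD₀]; abel
      rw [this]
      refine (norm_add_le _ _).trans ?_
      rw [norm_neg]
      linarith
    rw [hC]
    exact hG.inner_velocity_le hη hη1 (by linarith) hX hxte hlam hc hcY hWR hball hs hVs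

theorem abs_mul_mul_sub_le {x y z x' y' z' S t : ℝ} (ht0 : 0 ≤ t) (ht : t ≤ 1)
    (hx : |x| ≤ S) (hy : |y| ≤ S) (hz : |z| ≤ S) (hx' : |x' - x| ≤ t * S)
    (hy' : |y' - y| ≤ t * S) (hz' : |z' - z| ≤ t * S) :
    |x' * y' * z' - x * y * z| ≤ t * (7 * S ^ 3) := by
  have hS : 0 ≤ S := (abs_nonneg _).trans hx
  have htS : t * S ≤ S := mul_le_of_le_one_left hS ht
  have by' : |y'| ≤ 2 * S := by
    have := abs_add_le (y' - y) y
    rw [sub_add_cancel] at this; linarith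
  have bz' : |z'| ≤ 2 * S := by
    have := abs_add_le (z' - z) z
    rw [sub_add_cancel] at this; linarith
  have h : x' * y' * z' - x * y * z =
      (x' - x) * y' * z' + x * (y' - y) * z' + x * y * (z' - z) := by ring
  rw [h]
  refine (abs_add_le _ _).trans ((add_le_add_left (abs_add_le _ _) _).trans ?_)
  simp only [abs_mul]
  calc |x' - x| * |y'| * |z'| + |x| * |y' - y| * |z'| + |x| * |y| * |z' - z|
      ≤ t * S * (2 * S) * (2 * S) + S * (t * S) * (2 * S) + S * S * (t * S) := by gcongr
    _ = t * (7 * S ^ 3) := by ring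

/-- At smooth weights within `O(η)` of the ridge weights the influence estimate agrees with that of
the neural tangent kernel up to `O(η)`. -/
theorem GoodInit.abs_ihvpAt_sub_le (hG : GoodInit X xte η R a W0) (hη : 0 ≤ η) (hη1 : η ≤ 1)
    (hX : ∀ j, ‖X j‖ = 1) (hxte : ‖xte‖ = 1) {lam : ℝ} (hlam : 0 < lam) {Y : Fin n → ℝ}
    (hY : ∀ j, |Y j| ≤ 1) {yte : ℝ} (hyte : |yte| ≤ 1) (i : Fin n) {W : Params d m}
    (hWs : W ∈ smoothWeights m X xte) (hW : ‖W - W0‖ ≤ R) {t S : ℝ} (ht : 0 ≤ t)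
    (hD : ‖W - ridgeWeights X a W0 ((Ktr X + lam • (1 : Matrix (Fin n) (Fin n) ℝ))⁻¹.mulVec Y)‖
      ≤ η * t)
    (hS : S = 3 * (n * (n / lam) + (n * (n / lam)) ^ 2) + (n * (n / lam) + 1 + R + t)) :
    |ihvpAt lam X Y xte yte i a W - alpha lam X i xte * (fntk lam X Y xte - yte) *
      (fntk lam X Y (X i) - Y i)| ≤ η * (7 * S ^ 3) := by
  have hR0 : 0 ≤ R := (norm_nonneg _).trans hW
  have hPSD := dotProduct_Ktr_mulVec_nonneg hX
  set c := (Ktr X + lam • (1 : Matrix (Fin n) (Fin n) ℝ))⁻¹.mulVec Y with hc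
  have hcle : ∀ k, |c k| ≤ n / lam := fun k => by
    simpa using abs_ridge_inv_le hPSD hlam hY k
  set b : ℝ := n * (n / lam) with hb
  have hb0 : 0 ≤ b := by positivity
  have hK : ∀ (z : Option (Fin n)) k, |Kte X (z.elim xte X) k| ≤ 1 := fun z k =>
    abs_ntk_le (norm_elim_eq_one hX hxte z) (hX k)
  have hf : ∀ z : Option (Fin n), |fntk lam X Y (z.elim xte X)| ≤ b := fun z =>
    (abs_dotProduct_le (hK z) hcle).trans (by rw [one_mul])
  have hsingle : ∀ j, |(Pi.single i 1 : Fin n → ℝ) j| ≤ 1 := fun j => by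
    rw [Pi.single_apply]; split_ifs <;> simp
  have hα : |alpha lam X i xte| ≤ b :=
    (abs_dotProduct_le (hK none) fun j => by
      simpa using abs_ridge_inv_le hPSD hlam hsingle j).trans (by rw [one_mul])
  have hnet : ∀ z : Option (Fin n), |net a W (z.elim xte X) - fntk lam X Y (z.elim xte X)| ≤
      η * (b + 1 + R + t) := by
    intro z
    have h1 := hG.abs_net_sub_le hη hX hxte hcle hW z
    have h2 : |(inner ℝ (actFeat a W0 (z.elim xte X)) (W - ridgeWeights X a W0 c) : ℝ)| ≤ η * t :=
      ((abs_real_inner_le_norm _ _).trans (mul_le_of_le_one_left (norm_nonneg _)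
        (norm_actFeat_le_one hG.sq_eq_one W0 (norm_elim_eq_one hX hxte z)))).trans hD
    have h3 := abs_add_le (net a W (z.elim xte X) - Kte X (z.elim xte X) ⬝ᵥ c -
      inner ℝ (actFeat a W0 (z.elim xte X)) (W - ridgeWeights X a W0 c))
      (inner ℝ (actFeat a W0 (z.elim xte X)) (W - ridgeWeights X a W0 c))
    rw [sub_add_cancel] at h3
    exact h3.trans ((add_le_add h1 h2).trans (le_of_eq (by ring)))
  have hker : ∀ (z : Option (Fin n)) k, |(inner ℝ (actFeat a W (z.elim xte X)) (actFeat a W (X k)) : ℝ)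
      - ntk (z.elim xte X) (X k)| ≤ 3 * η := by
    intro z k
    have hg : ∀ z : Option (Fin n),
        ‖actFeat a W (z.elim xte X) - actFeat a W0 (z.elim xte X)‖ ≤ η := fun z =>
      norm_feat_sub_actFeat_le hG.sq_eq_one (norm_elim_eq_one hX hxte z)
        (fun r => act_mem_reluSubdiff _ _) hη (hG.card_le W hW z)
    have h0 := hG.abs_kernel_sub_le z k
    have h1 : |(inner ℝ (actFeat a W (z.elim xte X) - actFeat a W0 (z.elim xte X))
        (actFeat a W (X k)) : ℝ)| ≤ η :=
      (abs_real_inner_le_norm _ _).trans ((mul_le_of_le_one_right (norm_nonneg _)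
        (norm_actFeat_le_one hG.sq_eq_one W (hX k))).trans (hg z))
    have h2 : |(inner ℝ (actFeat a W0 (z.elim xte X))
        (actFeat a W (X k) - actFeat a W0 (X k)) : ℝ)| ≤ η :=
      (abs_real_inner_le_norm _ _).trans ((mul_le_of_le_one_left (norm_nonneg _)
        (norm_actFeat_le_one hG.sq_eq_one W0 (norm_elim_eq_one hX hxte z))).trans (hg (some k)))
    rw [inner_sub_left] at h1
    rw [inner_sub_right] at h2
    rw [abs_le] at *
    constructor <;> linarith [h0.1, h0.2, h1.1, h1.2, h2.1, h2.2]
  rw [ihvpAt_eq hlam X Y xte yte i a hWs]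
  have hbig : 0 ≤ 3 * (b + b ^ 2) := by positivity
  refine abs_mul_mul_sub_le hη hη1 ?_ ?_ ?_ ?_ ?_ ?_
  · linarith [sq_nonneg b]
  · have := abs_sub (fntk lam X Y xte) yte
    have h1 : |fntk lam X Y xte| ≤ b := hf none
    linarith
  · have := abs_sub (fntk lam X Y (X i)) (Y i)
    have h1 : |fntk lam X Y (X i)| ≤ b := hf (some i)
    linarith [hY i]
  · refine (abs_dotProduct_ridge_inv_sub_le hPSD
      (dotProduct_gram_mulVec_nonneg fun j => actFeat a W (X j)) hlam (hK none) (hker none)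
      (fun j k => hker (some j) k) hsingle).trans ?_
    have : 0 ≤ η * (b + 1 + R + t) := by positivity
    rw [hS]
    linarith
  · rw [sub_sub_sub_cancel_right]
    refine (hnet none).trans ?_
    exact mul_le_mul_of_nonneg_left (by linarith) hη
  · rw [sub_sub_sub_cancel_right]
    refine (hnet (some i)).trans ?_
    exact mul_le_mul_of_nonneg_left (by linarith) hη

theorem exists_mapClusterPt_of_eventually_abs_sub_le {α : Type*} {l : Filter α} [l.NeBot]
    {f : α → ℝ} {A ε : ℝ} (h : ∀ᶠ x in l, |f x - A| ≤ ε) : ∃ v, MapClusterPt v l f := by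
  obtain ⟨v, _, hv⟩ := (isCompact_closedBall A ε).exists_mapClusterPt (f := l) (u := f) (by
    rw [le_principal_iff]
    exact h)
  exact ⟨v, hv⟩

/-- The deterministic part: constants `η` and `R`, independent of the width and the data, such that
every trajectory from a good initialization has influence values, all of them within `ε` of the
neural tangent kernel one. -/
theorem exists_forall_goodInit (n : ℕ) {lam ε : ℝ} (hlam : 0 < lam) (hε : 0 < ε) :
    ∃ η R : ℝ, 0 < η ∧ ∀ (d m : ℕ) (X : Fin n → E d) (Y : Fin n → ℝ),
      (∀ j, ‖X j‖ = 1) → (∀ j, |Y j| ≤ 1) → ∀ (xte : E d) (yte : ℝ), ‖xte‖ = 1 → |yte| ≤ 1 →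
      ∀ (i : Fin n) (a : Fin m → ℝ) (W0 : Params d m), GoodInit X xte η R a W0 →
      ∀ W : ℝ → Params d m, IsGradientFlow lam X Y a W0 W →
        (∃ v, IsIHVPInfluence lam X Y xte yte i a W v) ∧
        ∀ v, IsIHVPInfluence lam X Y xte yte i a W v →
          |v - alpha lam X i xte * (fntk lam X Y xte - yte) * (fntk lam X Y (X i) - Y i)| ≤ ε := by
  -- `b` bounds `alpha`, `fntk` and `‖W⋆ - W0‖`; `R` leaves room for the trajectory, which stays
  -- within `b + 1` of `W⋆`; `C η` bounds the error in the drift, `S η` that of each of the three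
  -- factors of the influence, which are themselves bounded by `S`
  set b : ℝ := n * (n / lam) with hb
  have hb0 : 0 ≤ b := by positivity
  set R : ℝ := 2 * b + 2 with hR
  set C : ℝ := n * (2 * (b + 1 + R) + n + (b + 1)) with hC
  have hC0 : 0 ≤ C := by positivity
  set t : ℝ := C / lam + 2 with ht
  have hCl : 0 ≤ C / lam := by positivity
  have ht0 : 2 ≤ t := by linarith
  set S : ℝ := 3 * (b + b ^ 2) + (b + 1 + R + t) with hS
  have hS0 : 0 ≤ S := by positivity
  set Q : ℝ := t + 7 * S ^ 3 / ε with hQ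
  have hSε : 0 ≤ 7 * S ^ 3 / ε := by positivity
  have hQt : t ≤ Q := by linarith
  have hQ0 : 0 < Q := by linarith
  have hηt : 1 / Q * t ≤ 1 := by rw [one_div_mul_eq_div]; exact (div_le_one hQ0).mpr hQt
  have hη1 : 1 / Q ≤ 1 := by rw [div_le_one hQ0]; linarith
  have hηε : 1 / Q * (7 * S ^ 3) ≤ ε := by
    rw [one_div_mul_eq_div, div_le_iff₀ hQ0, hQ, mul_add, mul_div_cancel₀ _ hε.ne']
    nlinarith
  set η := 1 / Q with hη
  have hη0 : 0 < η := by positivity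
  have hηC : η * C / lam < 1 := by
    have : η * t = η * C / lam + 2 * η := by rw [ht]; ring
    linarith
  refine ⟨η, R, hη0, ?_⟩
  intro d m X Y hX hY xte yte hxte hyte i a W0 hG W hW
  have hPSD := dotProduct_Ktr_mulVec_nonneg hX
  set c := (Ktr X + lam • (1 : Matrix (Fin n) (Fin n) ℝ))⁻¹.mulVec Y with hc
  have hcle : ∀ k, |c k| ≤ n / lam := fun k => by
    simpa using abs_ridge_inv_le hPSD hlam hY k
  have htraj : ∀ T, 0 ≤ T → ‖W T - ridgeWeights X a W0 c‖ ^ 2 ≤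
      Real.exp (-lam * T) * b ^ 2 + (η * C / lam) ^ 2 := fun T hT =>
    hG.norm_sq_flow_sub_le hη0.le hη1 hX hxte hlam hcle (ridge_mulVec_inv hPSD hlam Y) hW
      (by linarith) hC hηC hT
  -- the trajectory ends in a ball around the ridge weights
  have hev : ∀ᶠ T in atTop, W T ∈ Metric.closedBall (ridgeWeights X a W0 c) (η * (t - 1)) := by
    have hlim : Tendsto (fun T => Real.exp (-lam * T) * b ^ 2 + (η * C / lam) ^ 2) atTop
        (𝓝 (0 * b ^ 2 + (η * C / lam) ^ 2)) := by
      refine Tendsto.add_const _ (Tendsto.mul_const _ (Real.tendsto_exp_atBot.comp ?_))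
      exact tendsto_id.const_mul_atTop_of_neg (by linarith)
    have hlt : 0 * b ^ 2 + (η * C / lam) ^ 2 < (η * (t - 1)) ^ 2 := by
      have : η * (t - 1) = η * C / lam + η := by rw [ht]; ring
      rw [this, zero_mul, zero_add]
      have : 0 ≤ η * C / lam := by positivity
      gcongr
      linarith
    filter_upwards [hlim.eventually_lt_const hlt, eventually_ge_atTop 0] with T h1 h2
    rw [mem_closedBall_iff_norm]
    refine le_of_sq_le_sq ((htraj T h2).trans h1.le) ?_
    exact mul_nonneg hη0.le (by linarith)
  -- the bound holds at all smooth weights near a limit point, hence for all values of the estimate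
  have hnear : ∀ Winf, MapClusterPt Winf atTop W →
      ∀ᶠ W' in 𝓝[smoothWeights m X xte] Winf, |ihvpAt lam X Y xte yte i a W' -
        alpha lam X i xte * (fntk lam X Y xte - yte) * (fntk lam X Y (X i) - Y i)| ≤ ε := by
    intro Winf hWinf
    have hmem := Metric.isClosed_closedBall.mem_of_mapClusterPt hWinf hev
    rw [mem_closedBall_iff_norm] at hmem
    filter_upwards [self_mem_nhdsWithin, nhdsWithin_le_nhds (Metric.ball_mem_nhds Winf hη0)]
      with W' hs hball
    rw [mem_ball_iff_norm] at hball
    have hD : ‖W' - ridgeWeights X a W0 c‖ ≤ η * t := by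
      have := norm_add_le (W' - Winf) (Winf - ridgeWeights X a W0 c)
      rw [sub_add_sub_cancel] at this
      linarith
    have hWR : ‖W' - W0‖ ≤ R := by
      have h1 := norm_add_le (W' - ridgeWeights X a W0 c) (ridgeWeights X a W0 c - W0)
      rw [sub_add_sub_cancel] at h1
      have h2 : ‖ridgeWeights X a W0 c - W0‖ ≤ b :=
        norm_ridgeWeights_sub_le hG.sq_eq_one hX hcle
      linarith
    exact (hG.abs_ihvpAt_sub_le hη0.le hη1 hX hxte hlam hY hyte i hs hWR (by linarith) hD hS).trans
      hηε
  refine ⟨?_, ?_⟩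
  · obtain ⟨Winf, _, hWinf⟩ := (isCompact_closedBall (ridgeWeights X a W0 c)
      (η * (t - 1))).exists_mapClusterPt (f := atTop) (u := W) (by
        rw [le_principal_iff]; exact hev)
    have hne : ∀ x : E d, ‖x‖ = 1 → x ≠ 0 := fun x hx h => by simp [h] at hx
    have : (𝓝[smoothWeights m X xte] Winf).NeBot := mem_closure_iff_nhdsWithin_neBot.mp
      (dense_smoothWeights (fun j => hne _ (hX j)) (hne _ hxte) Winf)
    obtain ⟨v, hv⟩ := exists_mapClusterPt_of_eventually_abs_sub_le (hnear Winf hWinf)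
    exact ⟨v, Winf, hWinf, hv⟩
  · rintro v ⟨Winf, hWinf, hv⟩
    have := Metric.isClosed_closedBall.mem_of_mapClusterPt hv (hnear Winf hWinf)
    exact this

end Conclusion

/-! ### Chebyshev bounds for independent sums -/

section Chebyshev

theorem measure_pi_abs_sum_sub_ge_le {Ω : Type*} {mΩ : MeasurableSpace Ω} {m : ℕ} {μ : Measure Ω}
    [IsProbabilityMeasure μ] {f : Fin m → Ω → ℝ} (hf : ∀ r, MemLp (f r) 2 μ) {t : ℝ} (ht : 0 < t) :
    (Measure.pi fun _ : Fin m => μ) {ω | t ≤ |∑ r, f r (ω r) - ∑ r, ∫ x, f r x ∂μ|} ≤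
      ENNReal.ofReal ((∑ r, Var[f r; μ]) / t ^ 2) := by
  have hL : ∀ r, MemLp (fun ω : Fin m → Ω => f r (ω r)) 2 (Measure.pi fun _ : Fin m => μ) :=
    fun r => (hf r).comp_measurePreserving (measurePreserving_eval _ r)
  have hS : MemLp (∑ r, fun ω : Fin m → Ω => f r (ω r)) 2 (Measure.pi fun _ : Fin m => μ) :=
    memLp_finsetSum' _ fun r _ => hL r
  have h := meas_ge_le_variance_div_sq hS ht
  rw [variance_sum_pi hf] at h
  have hI : (∫ ω, (∑ r, fun ω : Fin m → Ω => f r (ω r)) ω ∂(Measure.pi fun _ : Fin m => μ)) =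
      ∑ r, ∫ x, f r x ∂μ := by
    simp only [Finset.sum_apply]
    rw [integral_finsetSum _ fun r _ => (hL r).integrable (by norm_num)]
    exact Finset.sum_congr rfl fun r _ => integral_comp_eval (hf r).aestronglyMeasurable
  rw [hI] at h
  simpa only [Finset.sum_apply] using h

theorem variance_le_one_of_abs_le_one {Ω : Type*} {mΩ : MeasurableSpace Ω} {μ : Measure Ω}
    [IsProbabilityMeasure μ] {h : Ω → ℝ} (hm : AEMeasurable h μ) (hb : ∀ᵐ x ∂μ, |h x| ≤ 1) :
    Var[h; μ] ≤ 1 := by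
  have := variance_le_sq_of_bounded (a := -1) (b := 1)
    (hb.mono fun x hx => abs_le.mp hx) hm
  norm_num at this
  exact this

/-- Weak law of large numbers with a rate, for averages of a function bounded by one. -/
theorem measure_pi_abs_average_sub_ge_le {Ω : Type*} {mΩ : MeasurableSpace Ω} {m : ℕ}
    (hm : 0 < m) {μ : Measure Ω} [IsProbabilityMeasure μ] {h : Ω → ℝ} (hmeas : Measurable h)
    (hb : ∀ x, |h x| ≤ 1) {t : ℝ} (ht : 0 < t) :
    (Measure.pi fun _ : Fin m => μ) {ω | t ≤ |(1 / m) * ∑ r, h (ω r) - ∫ x, h x ∂μ|} ≤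
      ENNReal.ofReal (1 / (m * t ^ 2)) := by
  have hm' : (m : ℝ) ≠ 0 := by positivity
  have hL : MemLp (fun x => (1 / (m : ℝ)) * h x) 2 μ :=
    (MemLp.of_bound hmeas.aestronglyMeasurable 1 (Eventually.of_forall hb)).const_mul _
  have h1 := measure_pi_abs_sum_sub_ge_le (fun _ : Fin m => hL) ht
  have h2 : ∑ _r : Fin m, ∫ x, (1 / (m : ℝ)) * h x ∂μ = ∫ x, h x ∂μ := by
    rw [integral_const_mul]; simp [hm']
  simp only [h2, ← Finset.mul_sum] at h1
  refine h1.trans (ENNReal.ofReal_le_ofReal ?_)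
  have h3 := variance_le_one_of_abs_le_one (μ := μ) hmeas.aemeasurable (Eventually.of_forall hb)
  rw [← div_div]
  gcongr
  simp only [variance_const_mul, Finset.sum_const, Finset.card_univ, Fintype.card_fin,
    nsmul_eq_mul]
  calc (m : ℝ) * ((1 / m) ^ 2 * Var[h; μ]) ≤ m * ((1 / m) ^ 2 * 1) := by gcongr
    _ = 1 / (m : ℝ) := by field_simp

theorem exists_pos_measure_abs_le {Ω : Type*} {mΩ : MeasurableSpace Ω} {μ : Measure Ω}
    [IsFiniteMeasure μ] {f : Ω → ℝ} (hf : Measurable f) (h0 : μ {x | f x = 0} = 0) {ε : ℝ}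
    (hε : 0 < ε) : ∃ τ : ℝ, 0 < τ ∧ μ.real {x | |f x| ≤ τ} ≤ ε := by
  have hlim := tendsto_measure_iInter_atTop (μ := μ) (s := fun k : ℕ => {x | |f x| ≤ 1 / (k + 1)})
    (fun k => (measurableSet_le hf.abs measurable_const).nullMeasurableSet)
    (fun k l hkl x hx => le_trans (show |f x| ≤ 1 / ((l : ℝ) + 1) from hx)
      (one_div_le_one_div_of_le (by positivity)
        (by have : (k : ℝ) ≤ l := by exact_mod_cast hkl
            linarith))) ⟨0, measure_ne_top _ _⟩
  have hInter : ⋂ k : ℕ, {x | |f x| ≤ 1 / ((k : ℝ) + 1)} = {x | f x = 0} := by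
    ext x
    simp only [Set.mem_iInter, Set.mem_ofPred_eq]
    constructor
    · intro h
      have := ge_of_tendsto' (tendsto_one_div_add_atTop_nhds_zero_nat (𝕜 := ℝ)) h
      simpa using this
    · intro h k
      rw [h, abs_zero]; positivity
  rw [hInter, h0] at hlim
  obtain ⟨k, hk⟩ := (hlim.eventually_lt_const (ENNReal.ofReal_pos.mpr hε)).exists
  refine ⟨1 / ((k : ℝ) + 1), by positivity, ?_⟩
  exact ENNReal.toReal_le_of_le_ofReal hε.le hk.le

end Chebyshev

/-! ### The law of the initialization -/

section InitialLaw

/-- The law `N(0, κ² I_d)` of a single initial weight vector. -/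
noncomputable def neuronLaw (d : ℕ) (κ : ℝ) : Measure (E d) :=
  (stdGaussian (E d)).map fun w => κ • w

instance (d : ℕ) (κ : ℝ) : IsProbabilityMeasure (neuronLaw d κ) :=
  Measure.isProbabilityMeasure_map (by fun_prop)

instance : IsProbabilityMeasure (uniformOn ({-1, 1} : Set ℝ)) :=
  isProbabilityMeasure_uniformOn (Set.toFinite _) ⟨1, by simp⟩

theorem ae_mem_uniformOn_signs : ∀ᵐ x ∂(uniformOn ({-1, 1} : Set ℝ)), x ∈ ({-1, 1} : Set ℝ) :=
  ae_cond_mem (Set.toFinite _).measurableSet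

theorem integral_uniformOn_signs : ∫ x, x ∂(uniformOn ({-1, 1} : Set ℝ)) = 0 := by
  have hs : ({-1, 1} : Set ℝ) = (({-1, 1} : Finset ℝ) : Set ℝ) := by simp
  have h : ∫ x in ({-1, 1} : Set ℝ), x ∂Measure.count = 0 := by
    rw [hs, setIntegral_finset]
    · rw [Finset.sum_pair (by norm_num)]
      simp [Measure.real]
    · rw [← hs, Set.insert_eq, integrableOn_union]
      exact ⟨integrableOn_singleton (by simp) (by simp), integrableOn_singleton (by simp) (by simp)⟩
  rw [uniformOn, ProbabilityTheory.cond, integral_smul_measure, h, smul_zero]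

variable {d : ℕ} {κ : ℝ}

theorem integral_inner_sq_neuronLaw {x : E d} (hx : ‖x‖ = 1) :
    ∫ w, (inner ℝ w x : ℝ) ^ 2 ∂(neuronLaw d κ) = κ ^ 2 := by
  rw [neuronLaw, integral_map (by fun_prop) (by fun_prop)]
  simp only [real_inner_smul_left, mul_pow]
  rw [integral_const_mul]
  have h := variance_dual_stdGaussian (innerSL ℝ x)
  rw [variance_of_integral_eq_zero (by fun_prop) (integral_strongDual_stdGaussian _),
    innerSL_apply_norm, hx] at h
  have hc : ∀ w : E d, (inner ℝ w x : ℝ) = innerSL ℝ x w := fun w => real_inner_comm _ _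
  simp only [hc, h]
  norm_num

theorem integrable_inner_sq_neuronLaw (x : E d) :
    Integrable (fun w => (inner ℝ w x : ℝ) ^ 2) (neuronLaw d κ) := by
  rw [neuronLaw, integrable_map_measure (by fun_prop) (by fun_prop)]
  have h := (IsGaussian.memLp_dual (stdGaussian (E d)) (innerSL ℝ x) 2
    (by norm_num)).integrable_sq.const_mul (κ ^ 2)
  refine h.congr (Eventually.of_forall fun w => ?_)
  have hc : (inner ℝ w x : ℝ) = innerSL ℝ x w := real_inner_comm _ _
  rw [Function.comp_apply, real_inner_smul_left, mul_pow, hc]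

theorem neuronLaw_inner_eq_zero (hκ : 0 < κ) {x : E d} (hx : ‖x‖ = 1) :
    neuronLaw d κ {w | (inner ℝ w x : ℝ) = 0} = 0 := by
  rw [neuronLaw, Measure.map_apply (by fun_prop)
    (measurableSet_eq_fun (by fun_prop) (by fun_prop))]
  have h1 : (fun w : E d => κ • w) ⁻¹' {w | (inner ℝ w x : ℝ) = 0} = innerSL ℝ x ⁻¹' {0} := by
    ext w
    have hc : (inner ℝ w x : ℝ) = innerSL ℝ x w := real_inner_comm _ _
    simp only [Set.mem_preimage, Set.mem_ofPred_eq, real_inner_smul_left, hc, mul_eq_zero, hκ.ne',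
      false_or, Set.mem_singleton_iff]
  rw [h1, ← Measure.map_apply (by fun_prop) (measurableSet_singleton 0),
    IsGaussian.map_eq_gaussianReal]
  have : NullSingletonClass
      (gaussianReal (∫ w, innerSL ℝ x w ∂(stdGaussian (E d)))
        Var[innerSL ℝ x; stdGaussian (E d)].toNNReal) := by
    refine nullSingletonClass_gaussianReal ?_
    rw [variance_dual_stdGaussian, innerSL_apply_norm, hx]
    norm_num
  exact measure_singleton 0

theorem integral_act_mul_act_neuronLaw (hκ : 0 < κ) (x x' : E d) :
    ∫ w, act w x * act w x' * inner ℝ x x' ∂(neuronLaw d κ) = ntk x x' := by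
  rw [neuronLaw, integral_map (by fun_prop)
    (measurable_act_mul_act_mul_inner x x').aestronglyMeasurable, ntk_eq_integral]
  have h : ∀ w y : E d, act (κ • w) y = act w y := fun w y => by
    simp only [act, real_inner_smul_left, mul_nonneg_iff_of_pos_left hκ]
  simp only [h]

variable {m : ℕ}

instance : IsProbabilityMeasure (initLaw d m κ) := by
  have : IsProbabilityMeasure (Measure.pi fun _ : Fin m => neuronLaw d κ) := inferInstance
  unfold initLaw
  exact @Measure.prod.instIsProbabilityMeasure _ _ _ _ _ _ this inferInstance

theorem initLaw_eq : initLaw d m κ = (Measure.pi fun _ : Fin m => neuronLaw d κ).prod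
    (Measure.pi fun _ : Fin m => uniformOn ({-1, 1} : Set ℝ)) := rfl

theorem initLaw_fst_preimage (s : Set (Fin m → E d)) :
    initLaw d m κ (Prod.fst ⁻¹' s) = (Measure.pi fun _ : Fin m => neuronLaw d κ) s := by
  rw [initLaw_eq, ← Set.prod_univ, Measure.prod_prod, measure_univ, mul_one]

theorem ae_initLaw_sq_eq_one : ∀ᵐ ω ∂(initLaw d m κ), ∀ r, ω.2 r ^ 2 = 1 := by
  have h : ∀ᵐ a ∂(Measure.pi fun _ : Fin m => uniformOn ({-1, 1} : Set ℝ)), ∀ r, a r ^ 2 = 1 := by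
    refine ae_all_iff.mpr fun r => ?_
    have := (measurePreserving_eval (fun _ : Fin m => uniformOn ({-1, 1} : Set ℝ))
      r).quasiMeasurePreserving.ae ae_mem_uniformOn_signs
    filter_upwards [this] with a ha
    simp only [Function.eval, Set.mem_insert_iff, Set.mem_singleton_iff] at ha
    rcases ha with h | h <;> simp [h]
  rw [initLaw_eq]
  exact Measure.quasiMeasurePreserving_snd.ae h

theorem measurable_relu : Measurable relu := measurable_id.max measurable_const

/-- Chebyshev's inequality for the initial output: conditionally on the weights it is a signed sum
with mean zero and variance at most the average of `(w_rᵀ x)²`, which has expectation `κ²`. -/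
theorem initLaw_abs_net_ge_le (hm : 0 < m) {x : E d} (hx : ‖x‖ = 1) {t : ℝ} (ht : 0 < t) :
    initLaw d m κ {ω | t ≤ |net ω.2 (WithLp.toLp 2 ω.1) x|} ≤ ENNReal.ofReal (κ ^ 2 / t ^ 2) := by
  have hm' : (m : ℝ) ≠ 0 := by positivity
  have hnet : ∀ (w : Fin m → E d) (a : Fin m → ℝ), net a (WithLp.toLp 2 w) x =
      ∑ r, ((1 / Real.sqrt m) * relu (inner ℝ (w r) x)) * a r := fun w a => by
    rw [net, Finset.mul_sum]
    exact Finset.sum_congr rfl fun r _ => by ring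
  have hmeas : MeasurableSet {ω : (Fin m → E d) × (Fin m → ℝ) |
      t ≤ |net ω.2 (WithLp.toLp 2 ω.1) x|} := by
    simp only [hnet]
    refine measurableSet_le measurable_const (Measurable.abs ?_)
    refine Finset.measurable_sum _ fun r _ => ?_
    have h1 : Measurable fun ω : (Fin m → E d) × (Fin m → ℝ) => relu (inner ℝ (ω.1 r) x) :=
      measurable_relu.comp (by fun_prop)
    have h2 : Measurable fun ω : (Fin m → E d) × (Fin m → ℝ) => ω.2 r := by fun_prop
    exact (h1.const_mul _).mul h2
  have hsign : ∀ᵐ x ∂(uniformOn ({-1, 1} : Set ℝ)), |x| ≤ 1 := by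
    filter_upwards [ae_mem_uniformOn_signs] with x hx
    simp only [Set.mem_insert_iff, Set.mem_singleton_iff] at hx
    rcases hx with h | h <;> simp [h]
  have hid : MemLp (fun x : ℝ => x) 2 (uniformOn ({-1, 1} : Set ℝ)) :=
    MemLp.of_bound measurable_id.aestronglyMeasurable 1 hsign
  have hvar := variance_le_one_of_abs_le_one (h := fun x : ℝ => x) measurable_id.aemeasurable hsign
  have hslice : ∀ w : Fin m → E d, (Measure.pi fun _ : Fin m => uniformOn ({-1, 1} : Set ℝ))
      {a | t ≤ |net a (WithLp.toLp 2 w) x|} ≤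
      ENNReal.ofReal (∑ r, 1 / (m * t ^ 2) * (inner ℝ (w r) x : ℝ) ^ 2) := by
    intro w
    have h := measure_pi_abs_sum_sub_ge_le (fun r : Fin m =>
      hid.const_mul ((1 / Real.sqrt m) * relu (inner ℝ (w r) x))) ht
    have hmean : ∑ r, ∫ y : ℝ, (1 / Real.sqrt m) * relu (inner ℝ (w r) x) * y
        ∂(uniformOn ({-1, 1} : Set ℝ)) = 0 := by
      refine Finset.sum_eq_zero fun r _ => ?_
      rw [integral_const_mul, integral_uniformOn_signs, mul_zero]
    rw [hmean] at h
    simp only [sub_zero, ← hnet] at h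
    refine h.trans (ENNReal.ofReal_le_ofReal ?_)
    rw [Finset.sum_div]
    refine Finset.sum_le_sum fun r _ => ?_
    have h1 : relu (inner ℝ (w r) x) ^ 2 ≤ (inner ℝ (w r) x : ℝ) ^ 2 := by
      unfold relu
      rcases le_total 0 (inner ℝ (w r) x : ℝ) with h0 | h0
      · rw [max_eq_left h0]
      · rw [max_eq_right h0, zero_pow two_ne_zero]; exact sq_nonneg _
    rw [variance_const_mul]
    calc ((1 / Real.sqrt m) * relu (inner ℝ (w r) x)) ^ 2 *
          Var[fun x : ℝ => x; uniformOn ({-1, 1} : Set ℝ)] / t ^ 2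
        ≤ ((1 / Real.sqrt m) * relu (inner ℝ (w r) x)) ^ 2 * 1 / t ^ 2 := by gcongr
      _ = 1 / (m * t ^ 2) * relu (inner ℝ (w r) x) ^ 2 := by
          rw [mul_pow, div_pow, Real.sq_sqrt (Nat.cast_nonneg m)]
          field_simp
      _ ≤ 1 / (m * t ^ 2) * (inner ℝ (w r) x : ℝ) ^ 2 := by gcongr
  rw [initLaw_eq, Measure.prod_apply hmeas]
  refine (lintegral_mono hslice).trans ?_
  have hint : ∀ r : Fin m, Integrable (fun w : Fin m → E d =>
      1 / (m * t ^ 2) * (inner ℝ (w r) x : ℝ) ^ 2) (Measure.pi fun _ : Fin m => neuronLaw d κ) :=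
    fun r => (integrable_comp_eval (μ := fun _ : Fin m => neuronLaw d κ) (i := r)
      (integrable_inner_sq_neuronLaw x)).const_mul _
  rw [← ofReal_integral_eq_lintegral_ofReal (integrable_finsetSum _ fun r _ => hint r)
    (Eventually.of_forall fun w => Finset.sum_nonneg fun r _ => by positivity)]
  refine ENNReal.ofReal_le_ofReal (le_of_eq ?_)
  rw [integral_finsetSum _ fun r _ => hint r]
  have heval : ∀ r : Fin m, ∫ w : Fin m → E d, (inner ℝ (w r) x : ℝ) ^ 2
      ∂(Measure.pi fun _ : Fin m => neuronLaw d κ) = κ ^ 2 := fun r => by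
    rw [integral_comp_eval (μ := fun _ : Fin m => neuronLaw d κ) (i := r)
      (f := fun w : E d => (inner ℝ w x : ℝ) ^ 2)
      (integrable_inner_sq_neuronLaw x).aestronglyMeasurable, integral_inner_sq_neuronLaw hx]
  simp only [integral_const_mul, heval, Finset.sum_const, Finset.card_univ, Fintype.card_fin,
    nsmul_eq_mul]
  field_simp

end InitialLaw

/-! ### Probability of a good initialization -/

section GoodEvent

variable {d m n : ℕ}

/-- A neuron that may switch either starts in the slab of half-width `τ` around the kink or moves by
more than `τ`; the latter happens to at most `R² / τ²` neurons. -/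
theorem card_filter_abs_inner_le_le {W W0 : Params d m} {R τ : ℝ} (hτ : 0 < τ)
    (hW : ‖W - W0‖ ≤ R) (x : E d) :
    ((Finset.univ.filter fun r => |(inner ℝ (W0 r) x : ℝ)| ≤ ‖W r - W0 r‖).card : ℝ) ≤
      (Finset.univ.filter fun r => |(inner ℝ (W0 r) x : ℝ)| ≤ τ).card + R ^ 2 / τ ^ 2 := by
  set T := Finset.univ.filter fun r => τ < ‖W r - W0 r‖ with hT
  have hsub : (Finset.univ.filter fun r => |(inner ℝ (W0 r) x : ℝ)| ≤ ‖W r - W0 r‖) ⊆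
      (Finset.univ.filter fun r => |(inner ℝ (W0 r) x : ℝ)| ≤ τ) ∪ T := by
    intro r hr
    simp only [Finset.mem_filter, Finset.mem_univ, true_and, Finset.mem_union, hT] at hr ⊢
    rcases le_or_gt ‖W r - W0 r‖ τ with h | h
    · exact Or.inl (hr.trans h)
    · exact Or.inr h
  have hcard : ((Finset.univ.filter fun r => |(inner ℝ (W0 r) x : ℝ)| ≤ ‖W r - W0 r‖).card : ℝ) ≤
      (Finset.univ.filter fun r => |(inner ℝ (W0 r) x : ℝ)| ≤ τ).card + T.card := by
    exact_mod_cast (Finset.card_le_card hsub).trans (Finset.card_union_le _ _)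
  have hTR : (T.card : ℝ) * τ ^ 2 ≤ R ^ 2 := by
    calc (T.card : ℝ) * τ ^ 2 = ∑ _r ∈ T, τ ^ 2 := by simp
      _ ≤ ∑ r ∈ T, ‖(W - W0) r‖ ^ 2 := by
          refine Finset.sum_le_sum fun r hr => ?_
          have : τ < ‖W r - W0 r‖ := (Finset.mem_filter.mp hr).2
          rw [PiLp.sub_apply]
          gcongr
      _ ≤ ∑ r, ‖(W - W0) r‖ ^ 2 :=
          Finset.sum_le_sum_of_subset_of_nonneg (Finset.subset_univ _) fun _ _ _ => sq_nonneg _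
      _ = ‖W - W0‖ ^ 2 := (PiLp.norm_sq_eq_of_L2 _ _).symm
      _ ≤ R ^ 2 := by gcongr
  have : (T.card : ℝ) ≤ R ^ 2 / τ ^ 2 := (le_div_iff₀ (by positivity)).mpr hTR
  linarith

theorem measurable_indicator_abs_inner_le (x : E d) (τ : ℝ) :
    Measurable fun w : E d => if |(inner ℝ w x : ℝ)| ≤ τ then (1 : ℝ) else 0 :=
  Measurable.ite (measurableSet_le (by fun_prop) measurable_const) measurable_const measurable_const

theorem exists_goodInit_event (n : ℕ) {η R δ : ℝ} (hη : 0 < η) (hδ : 0 < δ) :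
    ∃ κ₀ : ℝ, 0 < κ₀ ∧ ∀ κ : ℝ, 0 < κ → κ ≤ κ₀ →
      ∀ (d : ℕ) (X : Fin n → E d), (∀ j, ‖X j‖ = 1) → ∀ xte : E d, ‖xte‖ = 1 →
      ∀ᶠ m : ℕ in atTop, ∃ G : Set ((Fin m → E d) × (Fin m → ℝ)), MeasurableSet G ∧
        1 - δ ≤ (initLaw d m κ).real G ∧
        ∀ ω ∈ G, GoodInit X xte η R ω.2 (WithLp.toLp 2 ω.1) := by
  -- apart from a null event, `(n + 1) (n + 2)` bad events share the failure probability equally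
  set δ' : ℝ := δ / ((n + 1) * (n + 2)) with hδ'
  have hδ'0 : 0 < δ' := by positivity
  refine ⟨η * Real.sqrt δ', by positivity, fun κ hκ hκ₀ d X hX xte hxte => ?_⟩
  have hz := norm_elim_eq_one hX hxte
  have hκη : κ ^ 2 / η ^ 2 ≤ δ' := by
    rw [div_le_iff₀ (by positivity)]
    calc κ ^ 2 ≤ (η * Real.sqrt δ') ^ 2 := by gcongr
      _ = δ' * η ^ 2 := by rw [mul_pow, Real.sq_sqrt hδ'0.le, mul_comm]
  -- thin slabs around the hyperplanes on which the neurons have a kink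
  have hslab : ∀ z : Option (Fin n), ∃ τ : ℝ, 0 < τ ∧
      (neuronLaw d κ).real {w | |(inner ℝ w (z.elim xte X) : ℝ)| ≤ τ} ≤ η ^ 2 / 4 := fun z =>
    exists_pos_measure_abs_le (by fun_prop) (neuronLaw_inner_eq_zero hκ (hz z)) (by positivity)
  choose τ hτ hτp using hslab
  have hbig : ∀ c : ℝ, ∀ᶠ m : ℕ in atTop, c ≤ (m : ℝ) := fun c =>
    tendsto_natCast_atTop_atTop.eventually_ge_atTop c
  filter_upwards [eventually_gt_atTop 0, hbig (1 / (δ' * (η ^ 2 / 4) ^ 2)),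
    hbig (1 / (δ' * η ^ 2)), eventually_all.mpr fun z => hbig (R ^ 2 / τ z ^ 2 / (η ^ 2 / 2))]
    with m hm0 hm1 hm2 hm3
  have hm0' : (0 : ℝ) < m := by exact_mod_cast hm0
  have hsmall : ∀ s : ℝ, 0 < s → 1 / (δ' * s ^ 2) ≤ m → 1 / (m * s ^ 2) ≤ δ' := by
    intro s hs h
    rw [div_le_iff₀ (by positivity)] at h ⊢
    linarith
  set μ := initLaw d m κ with hμ
  set ind : Option (Fin n) → E d → ℝ := fun z w =>
    if |(inner ℝ w (z.elim xte X) : ℝ)| ≤ τ z then 1 else 0 with hind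
  set ker : Option (Fin n) → Fin n → E d → ℝ := fun z k w =>
    act w (z.elim xte X) * act w (X k) * inner ℝ (z.elim xte X) (X k) with hker
  set A1 : Set ((Fin m → E d) × (Fin m → ℝ)) := {ω | ¬ ∀ r, ω.2 r ^ 2 = 1} with hA1
  set A2 : Option (Fin n) → Set ((Fin m → E d) × (Fin m → ℝ)) := fun z =>
    {ω | η ≤ |net ω.2 (WithLp.toLp 2 ω.1) (z.elim xte X)|} with hA2
  set A3 : Option (Fin n) → Fin n → Set ((Fin m → E d) × (Fin m → ℝ)) := fun z k =>
    Prod.fst ⁻¹' {w | η ≤ |(1 / m) * ∑ r, ker z k (w r) - ∫ w, ker z k w ∂(neuronLaw d κ)|}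
    with hA3
  set A4 : Option (Fin n) → Set ((Fin m → E d) × (Fin m → ℝ)) := fun z =>
    Prod.fst ⁻¹' {w | η ^ 2 / 4 ≤ |(1 / m) * ∑ r, ind z (w r) - ∫ w, ind z w ∂(neuronLaw d κ)|}
    with hA4
  have m1 : μ.real A1 = 0 := by
    rw [Measure.real, ae_iff.mp ae_initLaw_sq_eq_one, ENNReal.toReal_zero]
  have m2 : ∀ z, μ.real (A2 z) ≤ δ' := fun z =>
    ENNReal.toReal_le_of_le_ofReal hδ'0.le
      ((initLaw_abs_net_ge_le hm0 (hz z) hη).trans (ENNReal.ofReal_le_ofReal hκη))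
  have m3 : ∀ z k, μ.real (A3 z k) ≤ δ' := fun z k => by
    refine ENNReal.toReal_le_of_le_ofReal hδ'0.le ?_
    rw [hA3, hμ, initLaw_fst_preimage]
    exact (measure_pi_abs_average_sub_ge_le hm0 (measurable_act_mul_act_mul_inner _ _)
      (fun w => abs_act_mul_act_mul_inner_le w (hz z) (hX k)) hη).trans
      (ENNReal.ofReal_le_ofReal (hsmall η hη hm2))
  have m4 : ∀ z, μ.real (A4 z) ≤ δ' := fun z => by
    refine ENNReal.toReal_le_of_le_ofReal hδ'0.le ?_
    rw [hA4, hμ, initLaw_fst_preimage]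
    refine (measure_pi_abs_average_sub_ge_le hm0 (measurable_indicator_abs_inner_le _ _)
      (fun w => ?_) (by positivity)).trans (ENNReal.ofReal_le_ofReal (hsmall _ (by positivity) hm1))
    split_ifs <;> simp
  set A := A1 ∪ ((⋃ z, A2 z) ∪ ((⋃ z, ⋃ k, A3 z k) ∪ ⋃ z, A4 z)) with hA
  have hAle : μ.real A ≤ δ := by
    have h2 : μ.real (⋃ z, A2 z) ≤ (n + 1) * δ' := by
      refine (measureReal_iUnion_fintype_le _).trans ((Finset.sum_le_sum fun z _ => m2 z).trans ?_)
      simp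
    have h3 : μ.real (⋃ z, ⋃ k, A3 z k) ≤ (n + 1) * (n * δ') := by
      refine (measureReal_iUnion_fintype_le _).trans ((Finset.sum_le_sum fun z _ =>
        (measureReal_iUnion_fintype_le _).trans (Finset.sum_le_sum fun k _ => m3 z k)).trans ?_)
      simp
    have h4 : μ.real (⋃ z, A4 z) ≤ (n + 1) * δ' := by
      refine (measureReal_iUnion_fintype_le _).trans ((Finset.sum_le_sum fun z _ => m4 z).trans ?_)
      simp
    have h5 : (n + 1) * δ' + ((n + 1) * (n * δ') + (n + 1) * δ') = δ := by
      rw [hδ']; field_simp; ring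
    calc μ.real A ≤ μ.real A1 + (μ.real (⋃ z, A2 z) +
          (μ.real (⋃ z, ⋃ k, A3 z k) + μ.real (⋃ z, A4 z))) :=
          (measureReal_union_le _ _).trans (add_le_add le_rfl
            ((measureReal_union_le _ _).trans (add_le_add le_rfl (measureReal_union_le _ _))))
      _ ≤ δ := by rw [m1]; linarith
  -- a measurable hull of the bad event has the same probability
  refine ⟨(toMeasurable μ A)ᶜ, (measurableSet_toMeasurable μ A).compl, ?_, ?_⟩
  · rw [probReal_compl_eq_one_sub (measurableSet_toMeasurable μ A), Measure.real,
      measure_toMeasurable]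
    have : (μ A).toReal ≤ δ := hAle
    linarith
  · intro ω hω
    have hωA : ω ∉ A := fun h => hω (subset_toMeasurable μ A h)
    simp only [hA, Set.mem_union, Set.mem_iUnion, not_or, not_exists] at hωA
    obtain ⟨h1, h2, h3, h4⟩ := hωA
    have hsign : ∀ r, ω.2 r ^ 2 = 1 := not_not.mp h1
    refine ⟨hsign, fun z => (not_le.mp (h2 z)).le, fun z k => ?_, fun W hW z => ?_⟩
    · have h := h3 z k
      simp only [hA3, Set.mem_preimage, Set.mem_ofPred_eq, not_le] at h
      rw [hker, integral_act_mul_act_neuronLaw hκ] at h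
      rw [actFeat, actFeat, inner_feat_feat hsign]
      exact h.le
    · have h := h4 z
      simp only [hA4, Set.mem_preimage, Set.mem_ofPred_eq, not_le] at h
      have hint : ∫ w, ind z w ∂(neuronLaw d κ) ≤ η ^ 2 / 4 := by
        refine le_trans (le_of_eq ?_) (hτp z)
        rw [← integral_indicator_one (measurableSet_le (by fun_prop) measurable_const)]
        rfl
      have hsum : ∑ r, ind z (ω.1 r) =
          ((Finset.univ.filter fun r => |(inner ℝ (ω.1 r) (z.elim xte X) : ℝ)| ≤ τ z).card : ℝ) := by
        rw [hind, Finset.sum_boole]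
      rw [hsum] at h
      have h5 := card_filter_abs_inner_le_le (hτ z) hW (z.elim xte X)
      have h6 := (abs_lt.mp h).2
      have h7 : 1 / (m : ℝ) * ((Finset.univ.filter fun r =>
          |(inner ℝ (ω.1 r) (z.elim xte X) : ℝ)| ≤ τ z).card : ℝ) ≤ η ^ 2 / 2 := by linarith
      rw [one_div_mul_eq_div, div_le_iff₀ hm0'] at h7
      have h8 := hm3 z
      rw [div_le_iff₀ (by positivity)] at h8
      refine h5.trans ?_
      have h9 : ((Finset.univ.filter fun r => |(inner ℝ ((WithLp.toLp 2 ω.1 : Params d m) r)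
          (z.elim xte X) : ℝ)| ≤ τ z).card : ℝ) ≤ η ^ 2 / 2 * m := h7
      linarith

end GoodEvent

end IHVP

theorem proposition1 (n : ℕ) (lam : ℝ) (hlam : 0 < lam) (ε δ : ℝ) (hε : 0 < ε) (hδ : 0 < δ) :
    ∃ κ₀ : ℝ, 0 < κ₀ ∧ ∀ κ : ℝ, 0 < κ → κ ≤ κ₀ →
      ∀ (d : ℕ) (X : Fin n → IHVP.E d) (Y : Fin n → ℝ),
        (∀ j, ‖X j‖ = 1) → (∀ j, |Y j| ≤ 1) →
      ∀ (xte : IHVP.E d) (yte : ℝ), ‖xte‖ = 1 → |yte| ≤ 1 →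
      ∀ i : Fin n,
      ∀ᶠ m : ℕ in atTop,
        ∃ G : Set ((Fin m → IHVP.E d) × (Fin m → ℝ)), MeasurableSet G ∧
          1 - δ ≤ (IHVP.initLaw d m κ).real G ∧
          ∀ ω ∈ G, ∀ W : ℝ → IHVP.Params d m,
            IHVP.IsGradientFlow lam X Y ω.2 (WithLp.toLp 2 ω.1) W →
              (∀ W' ∈ IHVP.smoothWeights m X xte,
                (IHVP.hessian lam X Y ω.2 W').IsInvertible) ∧
              (∃ v, IHVP.IsIHVPInfluence lam X Y xte yte i ω.2 W v) ∧
              ∀ v, IHVP.IsIHVPInfluence lam X Y xte yte i ω.2 W v →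
                |v - IHVP.alpha lam X i xte * (IHVP.fntk lam X Y xte - yte) *
                  (IHVP.fntk lam X Y (X i) - Y i)| ≤ ε := by
  obtain ⟨η, R, hη, hdet⟩ := IHVP.exists_forall_goodInit n hlam hε
  obtain ⟨κ₀, hκ₀, hprob⟩ := IHVP.exists_goodInit_event n (R := R) hη hδ
  refine ⟨κ₀, hκ₀, fun κ hκ hκκ₀ d X Y hX hY xte yte hxte hyte i => ?_⟩
  filter_upwards [hprob κ hκ hκκ₀ d X hX xte hxte] with m ⟨G, hGm, hGδ, hG⟩
  exact ⟨G, hGm, hGδ, fun ω hω W hW => ⟨fun W' hW' => IHVP.hessian_isInvertible hlam Y ω.2 hW',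
    hdet d m X Y hX hY xte yte hxte hyte i ω.2 _ (hG ω hω) W hW⟩⟩
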